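/- \textbf{Group testing with partial recovery.} Fix $\rho\in[0,\tfrac12)$ and $\alpha^*\in(0,1)$, and let $k=k_p$ and $n=n_p$ be sequences of non-negative integers indexed by $p\in\mathbb{N}$, with $k\to\infty$ and $k=o(p)$ as $p\to\infty$. For each $p$ with $1\le k\le p$, let the defective set $S$ be uniformly distributed on the subsets of $\{1,\dots,p\}$ of size $k$; let the test matrix $\mathbf{X}=(X^{(i)}_j)\in\{0,1\}^{n\times p}$ have i.i.d. $\mathrm{Bernoulli}\big(\frac{\log 2}{k}\big)$ entries; and let the noise variables $Z^{(1)},\dots,Z^{(n)}$ be i.i.d. $\mathrm{Bernoulli}(\rho)$, where $S$, $\mathbf{X}$ and $(Z^{(i)})_i$ are independent. The test outcomes are $$Y^{(i)}=\mathbf{1}\Big\{\bigcup_{j\in S}\{X^{(i)}_j=1\}\Big\}\oplus Z^{(i)},\qquad i=1,\dots,n,$$ where $\oplus$ is addition modulo 2 (so $\rho=0$ is the noiseless case). A decoder is a deterministic map $(\mathbf{X},\mathbf{Y})\mapsto\hat S\subseteq\{1,\dots,p\}$ (which may depend on $p,k,n,\rho,\alpha^*$). With $d_{\max}=\lfloor\alpha^*k\rfloor$,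 its error probability is $$P_e(d_{\max})=\mathbb{P}\big[\,|S\setminus\hat S|>d_{\max}\ \text{ or }\ |\hat S\setminus S|>d_{\max}\,\big].$$ Let $\log$ denote the natural logarithm and $H_2(\rho)=-\rho\log\rho-(1-\rho)\log(1-\rho)$, with $0\log 0=0$. (i) If, for some constant $\eta>0$, for all sufficiently large $p$, $$n\ \ge\ \frac{k\log\frac pk}{\log 2-H_2(\rho)}\,(1+\eta),$$ then there is a sequence of decoders such that $P_e(d_{\max})\to0$ as $p\to\infty$. (ii) Conversely, if, for some constant $\eta>0$, for all sufficiently large $p$, $$n\ \le\ \frac{(1-\alpha^*)\,k\log\frac pk}{\log 2-H_2(\rho)}\,(1-\eta),$$ then for every sequence of decoders $P_e(d_{\max})\to1$ as $p\to\infty$. -/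

import Mathlib

open MeasureTheory ProbabilityTheory Filter Topology

/-- A realization of the random objects of the group testing problem with `p` items and `n` tests:
the defective set `S`, the test matrix `X` (`X i j = true` iff item `j` takes part in test `i`),
and the noise vector `Z`. -/
abbrev GTSpace (p n : ℕ) : Type :=
  Finset (Fin p) × (Fin n → Fin p → Bool) × (Fin n → Bool)

/-- The law of `(S, X, Z)`: the three are independent, `S` is uniform on the subsets of size `k`,
the entries of `X` are i.i.d. Bernoulli(`q`), and those of `Z` are i.i.d. Bernoulli(`ρ`). -/
noncomputable def gtLaw (p k n : ℕ) (q ρ : unitInterval) : Measure (GTSpace p n) :=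
  (uniformOn {S : Finset (Fin p) | S.card = k}).prod
    ((Measure.pi fun _ : Fin n => Measure.pi fun _ : Fin p => bernoulliMeasure true false q).prod
      (Measure.pi fun _ : Fin n => bernoulliMeasure true false ρ))

/-- The outcomes of the tests: `Y⁽ⁱ⁾ = 𝟙{⋃_{j ∈ S} {Xⱼ⁽ⁱ⁾ = 1}} ⊕ Z⁽ⁱ⁾`. -/
def gtOutcome {p n : ℕ} (ω : GTSpace p n) : Fin n → Bool :=
  fun i => xor (decide (∃ j ∈ ω.1, ω.2.1 i j = true)) (ω.2.2 i)

/-- A (deterministic) decoder forms an estimate of the defective set from the test matrix and the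
test outcomes. -/
abbrev GTDecoder (p n : ℕ) : Type :=
  (Fin n → Fin p → Bool) → (Fin n → Bool) → Finset (Fin p)

/-- The partial recovery error probability
`ℙ[|S \ Ŝ| > dmax ∪ |Ŝ \ S| > dmax]` of a decoder. -/
noncomputable def gtErrorProb {p n : ℕ} (k : ℕ) (q ρ : unitInterval) (dmax : ℕ)
    (dec : GTDecoder p n) : ℝ :=
  (gtLaw p k n q ρ).real
    {ω | dmax < (ω.1 \ dec ω.2.1 (gtOutcome ω)).card ∨
      dmax < (dec ω.2.1 (gtOutcome ω) \ ω.1).card}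

/-- The Bernoulli parameter `ν / k` with `ν = log 2` (only `k ≥ 1` is meaningful). -/
noncomputable def logTwoDiv (k : ℕ) : unitInterval :=
  ⟨Real.log 2 / k, by
    have h0 : 0 ≤ Real.log 2 := Real.log_nonneg (by norm_num)
    have h1 : Real.log 2 ≤ 1 := by linarith [Real.log_le_sub_one_of_pos (x := 2) (by norm_num)]
    refine ⟨by positivity, ?_⟩
    rcases Nat.eq_zero_or_pos k with rfl | hk
    · simp
    · have : (1 : ℝ) ≤ k := by exact_mod_cast hk
      exact div_le_one_of_le₀ (h1.trans this) (by positivity)⟩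

/-! Write `L = log (p / k)`, `C = log 2 - H₂(ρ)`, `r = 1 - q`. All probabilities are finite weighted
sums.

Converse (`one_sub_gtErrorProb_le`). Fix the test matrix. Up to a Chernoff error, the noise vector
is one of probability at most `exp (δ - n H₂(ρ))`. For fixed `S` the noise determines the outcome
bijectively, so it suffices to count pairs `(S, Y)` for which the decoder succeeds: each of the `2 ^
n` outcomes serves at most `exp (O(k)) (p / k) ^ d` sets (`card_near_le`), out of at least `(p / k)
^ k`. The success probability is thus about `exp (n C - (k - d) L)`, up to `δ + O(k)` in the
exponent. This holds matrix by matrix, so the design plays no role.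

Achievability (`gtErrorProb_thresholdDecoder_le`). Accept a `k`-set if, for each of its subsets `D`
with more than `d` elements, the likelihood ratio of the outcomes with and without knowledge of `D`
is at least `exp (γ |D|)`. The true set has at most `2 ^ k` such `D`; each fails with small
probability by Chernoff if `γ l` is sufficiently below `n I_l`, where `I_l = r ^ (k - l) * bscInfo ρ
(r ^ l)` is the mean log-ratio per test. A wrong set is `A ∪ D` with `A ⊆ S` and `D` disjoint from
`S`; its ratio has mean one (`sum_testWeight_mul_infoRatio`), so Markov's inequality and a union
bound apply with `γ l = l L + 3 k`.

It remains that `I_l` is at least nearly `(l / k) C`. Information per item does not increase with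
`l` (`div_mul_bscInfo_le`), and `I_k → C` since `r ^ k → 1 / 2`. Only `l > α k` matters, which keeps
the log-ratios bounded and makes the Chernoff exponent of order `k L`, beating `2 ^ k`. -/

/-! ### Probabilities as finite weighted sums -/

/-- The probability mass function of a Bernoulli(`q`) variable. -/
def bernWeight (q : ℝ) (b : Bool) : ℝ := if b then q else 1 - q

/-- The probability of a row of the test matrix. -/
def rowWeight {p : ℕ} (q : ℝ) (x : Fin p → Bool) : ℝ := ∏ j, bernWeight q (x j)

lemma bernWeight_nonneg {q : ℝ} (h0 : 0 ≤ q) (h1 : q ≤ 1) (b : Bool) : 0 ≤ bernWeight q b := by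
  cases b <;> simp [bernWeight, h0, h1]

lemma rowWeight_nonneg {p : ℕ} {q : ℝ} (h0 : 0 ≤ q) (h1 : q ≤ 1) (x : Fin p → Bool) :
    0 ≤ rowWeight q x := Finset.prod_nonneg fun _ _ => bernWeight_nonneg h0 h1 _

lemma sum_bernWeight (q : ℝ) : ∑ b, bernWeight q b = 1 := by simp [bernWeight]

lemma sum_prod_eq_prod_sum {ι A : Type*} [Fintype ι] [DecidableEq ι] [Fintype A]
    (f : ι → A → ℝ) : ∑ x : ι → A, ∏ i, f i (x i) = ∏ i, ∑ a, f i a := by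
  rw [Finset.prod_univ_sum, Fintype.piFinset_univ]

lemma sum_rowWeight {p : ℕ} (q : ℝ) : ∑ x : Fin p → Bool, rowWeight q x = 1 := by
  simp only [rowWeight]
  rw [sum_prod_eq_prod_sum (fun _ => bernWeight q), sum_bernWeight, Finset.prod_const_one]

lemma bernoulliMeasure_real_singleton (q : unitInterval) (b : Bool) :
    (bernoulliMeasure true false q).real {b} = bernWeight q b := by
  rw [bernoulliMeasure_real_apply _ (MeasurableSet.singleton b)]
  cases b <;> simp [bernWeight]

lemma measureReal_pi_singleton {ι A : Type*} [Fintype ι] [MeasurableSpace A]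
    (μ : ι → Measure A) [∀ i, IsProbabilityMeasure (μ i)] (f : ι → A) :
    (Measure.pi μ).real {f} = ∏ i, (μ i).real {f i} := by
  simp [measureReal_def, Measure.pi_singleton, ENNReal.toReal_prod]

lemma uniformOn_real_singleton (p k : ℕ) (S : Finset (Fin p)) :
    (uniformOn {S : Finset (Fin p) | S.card = k}).real {S} =
      if S ∈ Finset.powersetCard k Finset.univ then ((p.choose k : ℕ) : ℝ)⁻¹ else 0 := by
  have : {S : Finset (Fin p) | S.card = k} =
      ((Finset.powersetCard k Finset.univ : Finset (Finset (Fin p))) : Set _) := by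
    ext; simp
  rw [this, measureReal_def, uniformOn, cond_apply (Finset.measurableSet _),
    Measure.count_apply_finset]
  by_cases h : S ∈ Finset.powersetCard k Finset.univ
  · have h2 : ((Finset.powersetCard k Finset.univ : Finset (Finset (Fin p))) : Set _) ∩
        {S} = {S} := by
      ext; simp only [Set.mem_inter_iff, Set.mem_singleton_iff]; constructor
      · exact fun h => h.2
      · rintro rfl; exact ⟨h, rfl⟩
    rw [h2]
    simp [h]
  · have h2 : ((Finset.powersetCard k Finset.univ : Finset (Finset (Fin p))) : Set _) ∩
        {S} = ∅ := by
      ext; simp only [Set.mem_inter_iff, Set.mem_singleton_iff, Set.mem_empty_iff_false, iff_false]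
      rintro ⟨h1, rfl⟩; exact h h1
    rw [h2]
    simp only [if_neg h]
    simp

lemma gtLaw_real_singleton (p k n : ℕ) (q ρ : unitInterval) (ω : GTSpace p n) :
    (gtLaw p k n q ρ).real {ω} =
      (if ω.1 ∈ Finset.powersetCard k Finset.univ then ((p.choose k : ℕ) : ℝ)⁻¹ else 0) *
        ((∏ i, rowWeight (q : ℝ) (ω.2.1 i)) * ∏ i, bernWeight (ρ : ℝ) (ω.2.2 i)) := by
  obtain ⟨S, X, Z⟩ := ω
  rw [gtLaw, ← Set.singleton_prod_singleton, measureReal_prod_prod, ← Set.singleton_prod_singleton,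
    measureReal_prod_prod, uniformOn_real_singleton, measureReal_pi_singleton,
    measureReal_pi_singleton]
  simp only [measureReal_pi_singleton, bernoulliMeasure_real_singleton, rowWeight]

open Classical in
lemma gtLaw_real_eq_sum (p k n : ℕ) (q ρ : unitInterval) (A : Set (GTSpace p n)) :
    (gtLaw p k n q ρ).real A = ((p.choose k : ℕ) : ℝ)⁻¹ *
      ∑ S ∈ Finset.powersetCard k Finset.univ, ∑ X : Fin n → Fin p → Bool,
        (∏ i, rowWeight (q : ℝ) (X i)) * ∑ Z : Fin n → Bool,
          (∏ i, bernWeight (ρ : ℝ) (Z i)) * if (S, X, Z) ∈ A then 1 else 0 := by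
  have hfin : IsFiniteMeasure (gtLaw p k n q ρ) := by unfold gtLaw; infer_instance
  have h : (gtLaw p k n q ρ).real A = ∑ ω : GTSpace p n,
      (gtLaw p k n q ρ).real {ω} * if ω ∈ A then 1 else 0 := by
    have := sum_measureReal_singleton (μ := gtLaw p k n q ρ) (Finset.univ.filter (· ∈ A))
    rw [Finset.sum_filter] at this
    simp only [Finset.coe_filter, Finset.mem_univ, true_and, Set.ofPred_mem_eq] at this
    rw [← this]
    exact Finset.sum_congr rfl fun ω _ => by split_ifs <;> simp
  rw [h, Fintype.sum_prod_type, Finset.mul_sum,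
    ← Finset.sum_subset (Finset.subset_univ (Finset.powersetCard k Finset.univ))]
  · refine Finset.sum_congr rfl fun S hS => ?_
    rw [Fintype.sum_prod_type, Finset.mul_sum]
    refine Finset.sum_congr rfl fun X _ => ?_
    rw [Finset.mul_sum, Finset.mul_sum]
    refine Finset.sum_congr rfl fun Z _ => ?_
    rw [gtLaw_real_singleton, if_pos hS]
    ring
  · intro S _ hS
    refine Finset.sum_eq_zero fun XZ _ => ?_
    rw [gtLaw_real_singleton, if_neg hS]
    ring

lemma sum_fun_prod_eq_pow {A : Type*} [Fintype A] (n : ℕ) (f : A → ℝ) :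
    ∑ x : Fin n → A, ∏ i, f (x i) = (∑ a, f a) ^ n := by
  rw [sum_prod_eq_prod_sum (fun _ => f)]
  simp

/-! ### Chernoff bound and counting of sets -/

/-- A one-sided Chernoff bound for sums of i.i.d. bounded variables on a finite space. -/
lemma chernoff_lower_tail {A : Type*} [Fintype A] (n : ℕ) {w g : A → ℝ} {B t γ : ℝ}
    (hw : ∀ a, 0 ≤ w a) (hw1 : ∑ a, w a = 1) (hg : ∀ a, |g a| ≤ B) (ht : 0 ≤ t)
    (htB : t * B ≤ 1) :
    ∑ x : Fin n → A, (∏ i, w (x i)) * (if ∑ i, g (x i) ≤ γ then 1 else 0) ≤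
      Real.exp (t * (γ - n * ∑ a, w a * g a + n * (t * B ^ 2))) := by
  set m := ∑ a, w a * g a with hm
  -- Uses `exp y ≤ 1 + y + y ^ 2` for `|y| ≤ 1`, which is where `t * B ≤ 1` enters.
  have hstep : ∑ a, w a * Real.exp (-t * g a) ≤ Real.exp (-t * m + t ^ 2 * B ^ 2) := by
    have h1 : ∀ a, w a * Real.exp (-t * g a) ≤
        w a + (-t) * (w a * g a) + w a * (t ^ 2 * B ^ 2) := by
      intro a
      have habs : |-t * g a| ≤ t * B := by
        rw [abs_mul, abs_neg, abs_of_nonneg ht]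
        exact mul_le_mul_of_nonneg_left (hg a) ht
      have h2 := Real.abs_exp_sub_one_sub_id_le (habs.trans htB)
      have h3 : (-t * g a) ^ 2 ≤ t ^ 2 * B ^ 2 := by
        rw [← mul_pow, ← sq_abs (-t * g a)]
        exact pow_le_pow_left₀ (abs_nonneg _) habs 2
      have h4 := (abs_le.1 h2).2
      have h5 : Real.exp (-t * g a) ≤ 1 + (-t) * g a + t ^ 2 * B ^ 2 := by linarith
      calc _ ≤ w a * (1 + (-t) * g a + t ^ 2 * B ^ 2) := mul_le_mul_of_nonneg_left h5 (hw a)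
        _ = _ := by ring
    calc _ ≤ ∑ a, (w a + (-t) * (w a * g a) + w a * (t ^ 2 * B ^ 2)) :=
          Finset.sum_le_sum fun a _ => h1 a
      _ = -t * m + t ^ 2 * B ^ 2 + 1 := by
          rw [Finset.sum_add_distrib, Finset.sum_add_distrib, ← Finset.mul_sum, ← Finset.sum_mul,
            hw1]
          ring
      _ ≤ _ := Real.add_one_le_exp _
  calc ∑ x : Fin n → A, (∏ i, w (x i)) * (if ∑ i, g (x i) ≤ γ then 1 else 0)
      ≤ ∑ x : Fin n → A, Real.exp (t * γ) * ∏ i, w (x i) * Real.exp (-t * g (x i)) := by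
        refine Finset.sum_le_sum fun x _ => ?_
        rw [Finset.prod_mul_distrib, ← Real.exp_sum, ← Finset.mul_sum, mul_left_comm,
          ← Real.exp_add]
        refine mul_le_mul_of_nonneg_left ?_ (Finset.prod_nonneg fun _ _ => hw _)
        split_ifs with h
        · rw [← Real.exp_zero]
          refine Real.exp_le_exp.2 ?_
          nlinarith
        · exact (Real.exp_pos _).le
    _ = Real.exp (t * γ) * (∑ a, w a * Real.exp (-t * g a)) ^ n := by
        rw [← Finset.mul_sum, sum_fun_prod_eq_pow n fun a => w a * Real.exp (-t * g a)]
    _ ≤ Real.exp (t * γ) * Real.exp (-t * m + t ^ 2 * B ^ 2) ^ n := by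
        gcongr
        exact Finset.sum_nonneg fun a _ => mul_nonneg (hw a) (Real.exp_pos _).le
    _ = _ := by
        rw [← Real.exp_nat_mul, ← Real.exp_add]
        congr 1
        ring

/-- The sum is `(1 + x) ^ p`. With `x = k / p` the bound is `exp k`, which replaces upper estimates
of binomial coefficients in both directions of the theorem. -/
lemma sum_pow_card_le_exp (p : ℕ) {x : ℝ} (hx : 0 ≤ x) :
    ∑ D : Finset (Fin p), x ^ D.card ≤ Real.exp (p * x) := by
  have h := Fintype.sum_pow_mul_eq_add_pow (Fin p) x 1
  simp only [one_pow, mul_one, Fintype.card_fin] at h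
  rw [h, Real.exp_nat_mul]
  exact pow_le_pow_left₀ (by linarith) (Real.add_one_le_exp x) p

lemma div_pow_le_choose {p k : ℕ} (hk : 1 ≤ k) (hkp : k ≤ p) :
    ((p : ℝ) / k) ^ k ≤ p.choose k := by
  induction k, hk using Nat.le_induction generalizing p with
  | base => simp
  | succ k hk ih =>
    obtain ⟨p, rfl⟩ : ∃ m, p = m + 1 := ⟨p - 1, by omega⟩
    have hkp' : k ≤ p := by omega
    have hk0 : (0 : ℝ) < k := by exact_mod_cast hk
    have hkpR : (k : ℝ) ≤ p := by exact_mod_cast hkp'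
    have h1 := ih hkp'
    have h2 : ((p + 1 : ℕ) : ℝ) / ((k + 1 : ℕ) : ℝ) ≤ (p : ℝ) / k := by
      rw [div_le_div_iff₀ (by positivity) hk0]
      push_cast
      nlinarith
    have h3 : ((p + 1).choose (k + 1) : ℝ) =
        ((p + 1 : ℕ) : ℝ) / ((k + 1 : ℕ) : ℝ) * p.choose k := by
      have := Nat.add_one_mul_choose_eq p k
      rw [div_mul_eq_mul_div, eq_div_iff (by positivity)]
      exact_mod_cast this.symm
    rw [h3, pow_succ, mul_comm]
    exact mul_le_mul_of_nonneg_left ((pow_le_pow_left₀ (by positivity) h2 k).trans h1)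
      (by positivity)

/-- The number of sets that are recovered up to `d` errors by a fixed estimate. -/
lemma card_near_le {p k d : ℕ} (hk : 1 ≤ k) (hkp : k ≤ p) (hd : d ≤ k) (T : Finset (Fin p)) :
    (((Finset.powersetCard k Finset.univ).filter fun S : Finset (Fin p) =>
      (S \ T).card ≤ d ∧ (T \ S).card ≤ d).card : ℝ) ≤
      2 ^ (2 * k) * (((p : ℝ) / k) ^ d * Real.exp k) := by
  set F := (Finset.powersetCard k Finset.univ).filter fun S : Finset (Fin p) =>
      (S \ T).card ≤ d ∧ (T \ S).card ≤ d with hF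
  have hk0 : (0 : ℝ) < k := by exact_mod_cast hk
  have hkpR : (k : ℝ) ≤ p := by exact_mod_cast hkp
  have hp0 : (0 : ℝ) < p := hk0.trans_le hkpR
  rcases F.eq_empty_or_nonempty with h0 | ⟨S₀, hS₀⟩
  · rw [h0]; simp only [Finset.card_empty, Nat.cast_zero]; positivity
  have hTcard : T.card ≤ 2 * k := by
    rw [hF, Finset.mem_filter, Finset.mem_powersetCard] at hS₀
    obtain ⟨⟨-, h1⟩, -, h2⟩ := hS₀
    have h3 := Finset.card_sdiff_add_card_inter T S₀
    have h4 : (T ∩ S₀).card ≤ S₀.card := Finset.card_le_card Finset.inter_subset_right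
    omega
  set E := Finset.univ.filter fun D : Finset (Fin p) => D.card ≤ d with hE
  -- `S` is encoded by `S ∩ T` and `S \ T`. The first has at most `2 ^ (2 * k)` values; the second
  -- is a set of size at most `d`.
  have hcard : F.card ≤ (T.powerset ×ˢ E).card := by
    refine Finset.card_le_card_of_injOn (fun S => (S ∩ T, S \ T)) ?_ ?_
    · intro S hS
      rw [Finset.mem_coe, hF, Finset.mem_filter] at hS
      simp [hE, hS.2.1]
    · intro S _ S' _ h
      simp only [Prod.mk.injEq] at h
      rw [← Finset.sdiff_union_inter S T, ← Finset.sdiff_union_inter S' T, h.1, h.2]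
  rw [Finset.card_product, Finset.card_powerset] at hcard
  have hx1 : (1 : ℝ) ≤ p / k := (one_le_div hk0).2 hkpR
  have hD : (E.card : ℝ) ≤ ((p : ℝ) / k) ^ d * Real.exp k := by
    calc (E.card : ℝ)
        = ∑ D : Finset (Fin p), if D.card ≤ d then (1 : ℝ) else 0 := by simp [hE]
      -- Since `p / k ≥ 1`, the indicator of `|D| ≤ d` is at most `(p / k) ^ (d - |D|)`.
      _ ≤ ∑ D : Finset (Fin p), ((p : ℝ) / k) ^ d * ((k : ℝ) / p) ^ D.card := by
          refine Finset.sum_le_sum fun D _ => ?_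
          split_ifs with h
          · have : ((k : ℝ) / p) = ((p : ℝ) / k)⁻¹ := by rw [inv_div]
            rw [this, inv_pow, ← div_eq_mul_inv, one_le_div (by positivity)]
            exact pow_le_pow_right₀ hx1 h
          · positivity
      _ ≤ _ := by
          rw [← Finset.mul_sum]
          refine mul_le_mul_of_nonneg_left ?_ (by positivity)
          refine (sum_pow_card_le_exp p (by positivity)).trans (le_of_eq ?_)
          congr 1
          field_simp
  calc (F.card : ℝ) ≤ (2 : ℝ) ^ T.card * (E.card : ℝ) := by exact_mod_cast hcard
    _ ≤ _ := mul_le_mul (pow_le_pow_right₀ (by norm_num) hTcard) hD (by positivity) (by positivity)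

/-! ### The strong converse -/

lemma sum_bernWeight_mul_neg_log (r : ℝ) :
    ∑ b, bernWeight r b * -Real.log (bernWeight r b) = Real.binEntropy r := by
  simp [bernWeight, Real.binEntropy, add_comm]

/-- Valid also for `r = 0`, by `log 0 = 0`; thus noiseless tests need no separate treatment in the
Chernoff bounds. -/
lemma abs_log_bernWeight_le (r : ℝ) (b : Bool) :
    |Real.log (bernWeight r b)| ≤ |Real.log r| + |Real.log (1 - r)| := by
  cases b <;> simp [bernWeight]

/-- The noiseless test outcomes. -/
def hits {p : ℕ} (x : Fin p → Bool) (S : Finset (Fin p)) : Bool := decide (∃ j ∈ S, x j = true)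

open Classical in
lemma one_sub_gtErrorProb_eq {p k n : ℕ} (hkp : k ≤ p) (q ρ : unitInterval) (d : ℕ)
    (dec : GTDecoder p n) :
    1 - gtErrorProb k q ρ d dec = (gtLaw p k n q ρ).real
      {ω | (ω.1 \ dec ω.2.1 (gtOutcome ω)).card ≤ d ∧
        (dec ω.2.1 (gtOutcome ω) \ ω.1).card ≤ d} := by
  have hne : {S : Finset (Fin p) | S.card = k}.Nonempty := by
    obtain ⟨S, hS⟩ := Finset.powersetCard_nonempty.2
      (show k ≤ (Finset.univ : Finset (Fin p)).card by simpa using hkp)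
    exact ⟨S, (Finset.mem_powersetCard.1 hS).2⟩
  have := isProbabilityMeasure_uniformOn (Set.toFinite {S : Finset (Fin p) | S.card = k}) hne
  have hprob : IsProbabilityMeasure (gtLaw p k n q ρ) := by unfold gtLaw; infer_instance
  rw [gtErrorProb, ← probReal_compl_eq_one_sub (Set.toFinite _).measurableSet]
  congr 1
  ext ω
  simp

/-- A non-asymptotic strong converse for partial recovery. -/
lemma one_sub_gtErrorProb_le {p k n d : ℕ} (hk : 1 ≤ k) (hkp : k ≤ p) (hd : d ≤ k)
    (q ρ : unitInterval) (dec : GTDecoder p n) {B t δ : ℝ}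
    (hB : |Real.log ρ| + |Real.log (1 - ρ)| ≤ B) (ht : 0 ≤ t) (htB : t * B ≤ 1) :
    1 - gtErrorProb k q ρ d dec ≤ Real.exp (t * (-δ + n * (t * B ^ 2))) +
      Real.exp (δ - n * Real.binEntropy ρ) *
        (((p : ℝ) / k) ^ k)⁻¹ * (2 ^ n * (2 ^ (2 * k) * (((p : ℝ) / k) ^ d * Real.exp k))) := by
  classical
  have hk0 : (0 : ℝ) < k := by exact_mod_cast hk
  have hp0 : (0 : ℝ) < p := hk0.trans_le (by exact_mod_cast hkp)
  set H := Real.binEntropy ρ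
  set E := Real.exp (δ - n * H)
  set c := Real.exp (t * (-δ + n * (t * B ^ 2)))
  set M : ℝ := 2 ^ (2 * k) * (((p : ℝ) / k) ^ d * Real.exp k)
  have hw := bernWeight_nonneg ρ.2.1 ρ.2.2
  set V : (Fin n → Bool) → ℝ := fun Z => ∏ i, bernWeight (ρ : ℝ) (Z i) with hV
  have hV0 : ∀ Z, 0 ≤ V Z := fun Z => Finset.prod_nonneg fun _ _ => hw _
  set typ : (Fin n → Bool) → Prop :=
    fun Z => n * H - δ < ∑ i, -Real.log (bernWeight (ρ : ℝ) (Z i)) with htyp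
  have hatyp : ∑ Z, V Z * (if ¬ typ Z then 1 else 0) ≤ c := by
    have := chernoff_lower_tail n (γ := n * H - δ) hw (sum_bernWeight ρ)
      (g := fun b => -Real.log (bernWeight (ρ : ℝ) b))
      (fun b => by rw [abs_neg]; exact (abs_log_bernWeight_le _ b).trans hB) ht htB
    rw [sum_bernWeight_mul_neg_log] at this
    simp only [htyp, not_lt]
    refine this.trans (le_of_eq ?_)
    congr 2
    ring
  have hVtyp : ∀ Z, typ Z → V Z ≤ E := by
    intro Z hZ
    -- Noise of weight zero is set apart: there the value `log 0 = 0` says nothing about `V Z`.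
    rcases (hV0 Z).eq_or_lt with h | h
    · rw [← h]; exact (Real.exp_pos _).le
    · have hne : ∀ i ∈ Finset.univ, bernWeight (ρ : ℝ) (Z i) ≠ 0 := fun i hi h0 =>
        h.ne' (Finset.prod_eq_zero hi h0)
      rw [← Real.exp_log h, hV, Real.log_prod hne]
      refine Real.exp_le_exp.2 ?_
      simp only [htyp, Finset.sum_neg_distrib] at hZ
      linarith
  set good : Finset (Fin p) → Finset (Fin p) → Prop :=
    fun S T => (S \ T).card ≤ d ∧ (T \ S).card ≤ d with hgood
  have hfix : ∀ X : Fin n → Fin p → Bool,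
      ∑ S ∈ Finset.powersetCard k Finset.univ, ∑ Z, V Z *
        (if good S (dec X fun i => xor (hits (X i) S) (Z i)) then 1 else 0) ≤
      p.choose k * c + E * (2 ^ n * M) := by
    intro X
    have hpt : ∀ S Z, V Z *
        (if good S (dec X fun i => xor (hits (X i) S) (Z i)) then 1 else 0) ≤
        V Z * (if ¬ typ Z then 1 else 0) +
          E * (if good S (dec X fun i => xor (hits (X i) S) (Z i)) then 1 else 0) := by
      intro S Z
      have hE : 0 < E := Real.exp_pos _
      have := hV0 Z
      by_cases h1 : typ Z
      · have := hVtyp Z h1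
        split_ifs <;> simp_all
      · rw [if_pos h1]
        split_ifs <;> nlinarith
    -- With `X` and `S` fixed, adding the noiseless outcomes is an involution exchanging `Z` and
    -- `Y`.
    have hbij : ∀ S, ∑ Z : Fin n → Bool,
        (if good S (dec X fun i => xor (hits (X i) S) (Z i)) then (1 : ℝ) else 0) =
        ∑ Y : Fin n → Bool, if good S (dec X Y) then (1 : ℝ) else 0 := by
      intro S
      have hinv : Function.Involutive
          (fun (Z : Fin n → Bool) => fun i => xor (hits (X i) S) (Z i)) := by
        intro Z; funext i; simp
      exact (Equiv.sum_comp hinv.toPerm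
        fun Y => if good S (dec X Y) then (1 : ℝ) else 0)
    calc _ ≤ ∑ S ∈ Finset.powersetCard k Finset.univ, (c + E * ∑ Y : Fin n → Bool,
          if good S (dec X Y) then (1 : ℝ) else 0) := by
          refine Finset.sum_le_sum fun S _ => ?_
          refine (Finset.sum_le_sum fun Z _ => hpt S Z).trans ?_
          rw [Finset.sum_add_distrib, ← Finset.mul_sum, hbij]
          gcongr
      _ = p.choose k * c + E * ∑ Y : Fin n → Bool,
          ∑ S ∈ Finset.powersetCard k Finset.univ, if good S (dec X Y) then (1 : ℝ) else 0 := by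
          rw [Finset.sum_add_distrib, ← Finset.mul_sum, Finset.sum_comm]
          simp
      _ ≤ _ := by
          gcongr
          calc _ ≤ ∑ Y : Fin n → Bool, M := by
                refine Finset.sum_le_sum fun Y _ => ?_
                rw [← Finset.sum_filter, Finset.sum_const, nsmul_eq_mul, mul_one]
                exact card_near_le hk hkp hd _
            _ = _ := by simp
  have hX : ∑ X : Fin n → Fin p → Bool, ∏ i, rowWeight (q : ℝ) (X i) = 1 := by
    rw [sum_fun_prod_eq_pow n (fun x : Fin p → Bool => rowWeight (q : ℝ) x), sum_rowWeight, one_pow]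
  have hC : (0 : ℝ) < p.choose k := by exact_mod_cast Nat.choose_pos hkp
  rw [one_sub_gtErrorProb_eq hkp, gtLaw_real_eq_sum, Finset.sum_comm]
  calc _ ≤ ((p.choose k : ℕ) : ℝ)⁻¹ * ∑ X : Fin n → Fin p → Bool,
        (∏ i, rowWeight (q : ℝ) (X i)) * (p.choose k * c + E * (2 ^ n * M)) := by
        refine mul_le_mul_of_nonneg_left (Finset.sum_le_sum fun X _ => ?_) (by positivity)
        rw [← Finset.mul_sum]
        refine mul_le_mul_of_nonneg_left ?_
          (Finset.prod_nonneg fun i _ => rowWeight_nonneg q.2.1 q.2.2 _)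
        refine le_of_eq_of_le (Finset.sum_congr rfl fun S _ => Finset.sum_congr rfl fun Z _ => ?_)
          (hfix X)
        congr 1
        simp only [hits, hgood, Set.mem_ofPred_eq]
        congr 1
    _ = c + E * (p.choose k : ℝ)⁻¹ * (2 ^ n * M) := by
        rw [← Finset.sum_mul, hX, one_mul]
        field_simp
    _ ≤ _ := by
        gcongr
        exact div_pow_le_choose hk hkp

lemma log_two_sub_binEntropy_pos {r : ℝ} (h : r < 1 / 2) : 0 < Real.log 2 - Real.binEntropy r :=
  sub_pos.2 (Real.binEntropy_lt_log_two.2 (by norm_num at h ⊢; exact h.ne))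

lemma gtErrorProb_nonneg {p k n : ℕ} (q ρ : unitInterval) (d : ℕ) (dec : GTDecoder p n) :
    0 ≤ gtErrorProb k q ρ d dec := measureReal_nonneg

lemma tendsto_log_div_atTop {k : ℕ → ℕ} (hk : Tendsto k atTop atTop)
    (hkp : (fun p => (k p : ℝ)) =o[atTop] (fun p : ℕ => (p : ℝ))) :
    Tendsto (fun p : ℕ => Real.log ((p : ℝ) / (k p : ℝ))) atTop atTop := by
  refine Real.tendsto_log_atTop.comp ?_
  have h1 : Tendsto (fun p : ℕ => (k p : ℝ) / p) atTop (𝓝[>] 0) := by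
    refine tendsto_nhdsWithin_iff.2 ⟨hkp.tendsto_div_nhds_zero, ?_⟩
    filter_upwards [hk.eventually_ge_atTop 1, eventually_ge_atTop 1] with p h1 h2
    have h1 : (0 : ℝ) < k p := by exact_mod_cast h1
    have h2 : (0 : ℝ) < p := by exact_mod_cast h2
    exact div_pos h1 h2
  refine h1.inv_tendsto_nhdsGT_zero.congr fun p => ?_
  simp

lemma eventually_le_of_isLittleO {k : ℕ → ℕ}
    (hkp : (fun p => (k p : ℝ)) =o[atTop] (fun p : ℕ => (p : ℝ))) : ∀ᶠ p in atTop, k p ≤ p := by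
  filter_upwards [hkp.bound one_pos] with p hp
  simp only [Real.norm_natCast, one_mul] at hp
  exact_mod_cast hp

/-- The parameter `q` is arbitrary because the finite bound holds for each test matrix separately.
-/
theorem tendsto_gtErrorProb_one (ρ : unitInterval) (hρ : (ρ : ℝ) < 1 / 2)
    (α : ℝ) (hα0 : 0 < α) (hα1 : α < 1) (k n : ℕ → ℕ) (hk : Tendsto k atTop atTop)
    (hkp : (fun p => (k p : ℝ)) =o[atTop] (fun p : ℕ => (p : ℝ)))
    {η : ℝ} (hη : 0 < η) (hn : ∀ᶠ p : ℕ in atTop,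
        (n p : ℝ) ≤ ((1 - α) * ((k p : ℝ) * Real.log ((p : ℝ) / (k p : ℝ))))
          / (Real.log 2 - Real.binEntropy (ρ : ℝ)) * (1 - η))
    (q : ℕ → unitInterval) (dec : ∀ p : ℕ, GTDecoder p (n p)) :
    Tendsto (fun p : ℕ => gtErrorProb (k p) (q p) ρ ⌊α * (k p : ℝ)⌋₊ (dec p)) atTop (𝓝 1) := by
  set C := Real.log 2 - Real.binEntropy (ρ : ℝ) with hC
  have hC0 : 0 < C := log_two_sub_binEntropy_pos hρ
  -- With `N = k L`, the gap between `n C` and `(1 - α) N` is at least `2 ε N`: `δ` takes `ε N`, the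
  -- `O(k)` terms `ε N / 2`, and `ε N / 2` remains as decay.
  set ε := (1 - α) * η / 2 with hε
  have hε0 : 0 < ε := by have : 0 < 1 - α := by linarith
                         positivity
  set B := |Real.log ρ| + |Real.log (1 - ρ)| + 1 with hB
  have hB0 : 0 < B := by positivity
  -- The second entry keeps the quadratic Chernoff term `n t B ^ 2` below `δ / 2`.
  set t := min (1 / B) (ε * C / (2 * B ^ 2)) with ht
  have ht0 : 0 < t := lt_min (by positivity) (by positivity)
  have htB : t * B ≤ 1 := by
    calc t * B ≤ 1 / B * B := by gcongr; exact min_le_left _ _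
      _ = 1 := by field_simp
  have htB2 : t * B ^ 2 ≤ ε * C / 2 := by
    calc t * B ^ 2 ≤ ε * C / (2 * B ^ 2) * B ^ 2 := by gcongr; exact min_le_right _ _
      _ = _ := by field_simp
  set L : ℕ → ℝ := fun p => Real.log ((p : ℝ) / (k p : ℝ)) with hL
  set N : ℕ → ℝ := fun p => (k p : ℝ) * L p with hN
  have hLtop : Tendsto L atTop atTop := tendsto_log_div_atTop hk hkp
  have hkR : Tendsto (fun p => (k p : ℝ)) atTop atTop := tendsto_natCast_atTop_atTop.comp hk
  have hNtop : Tendsto N atTop atTop := hkR.atTop_mul_atTop₀ hLtop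
  have hbound : ∀ᶠ p in atTop, 1 - gtErrorProb (k p) (q p) ρ ⌊α * (k p : ℝ)⌋₊ (dec p) ≤
      Real.exp (-(t * (ε / 2) * N p)) + Real.exp (-(ε / 2 * N p)) := by
    filter_upwards [hn, hk.eventually_ge_atTop 1, eventually_le_of_isLittleO hkp,
      hLtop.eventually_ge_atTop (6 / ε), hLtop.eventually_ge_atTop 0] with p hnp hk1 hkp1 hL1 hL0
    have hk0 : (0 : ℝ) < k p := by exact_mod_cast hk1
    have hp0 : (0 : ℝ) < p := hk0.trans_le (by exact_mod_cast hkp1)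
    have hd : (⌊α * (k p : ℝ)⌋₊ : ℝ) ≤ α * k p := Nat.floor_le (by positivity)
    have hdk : ⌊α * (k p : ℝ)⌋₊ ≤ k p := by
      have : (⌊α * (k p : ℝ)⌋₊ : ℝ) ≤ k p := by nlinarith
      exact_mod_cast this
    have hN0 : 0 ≤ N p := mul_nonneg hk0.le hL0
    have hnC : (n p : ℝ) * C ≤ (1 - α) * (1 - η) * N p := by
      calc (n p : ℝ) * C ≤ ((1 - α) * N p / C * (1 - η)) * C := by gcongr
        _ = _ := by field_simp
    have hexp : (p : ℝ) / k p = Real.exp (L p) := (Real.exp_log (by positivity)).symm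
    refine (one_sub_gtErrorProb_le hk1 hkp1 hdk (q p) ρ (dec p) (B := B) (t := t) (δ := ε * N p)
      (by rw [hB]; linarith) ht0.le htB).trans (add_le_add ?_ ?_)
    · refine Real.exp_le_exp.2 ?_
      have h1 : (n p : ℝ) * (t * B ^ 2) ≤ ε / 2 * N p := by
        calc (n p : ℝ) * (t * B ^ 2) ≤ n p * (ε * C / 2) := by gcongr
          _ = ε / 2 * (n p * C) := by ring
          _ ≤ ε / 2 * N p := by
            gcongr
            refine hnC.trans ?_
            have : (1 - α) * (1 - η) ≤ 1 := by nlinarith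
            nlinarith
      nlinarith
    · rw [hexp, ← Real.exp_nat_mul, ← Real.exp_nat_mul, ← Real.exp_neg]
      have h2 : ∀ m : ℕ, (2 : ℝ) ^ m = Real.exp (m * Real.log 2) := by
        intro m; rw [Real.exp_nat_mul, Real.exp_log two_pos]
      rw [h2, h2]
      simp only [← Real.exp_add]
      refine Real.exp_le_exp.2 ?_
      push_cast
      have hlog2 : Real.log 2 ≤ 1 := by
        linarith [Real.log_le_sub_one_of_pos (x := 2) (by norm_num)]
      have h3 : (⌊α * (k p : ℝ)⌋₊ : ℝ) * L p ≤ α * N p := by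
        calc _ ≤ α * k p * L p := by gcongr
          _ = _ := by rw [hN]; ring
      have h4 : 3 * (k p : ℝ) ≤ ε / 2 * N p := by
        have : 3 ≤ ε / 2 * L p := by
          calc (3 : ℝ) = ε / 2 * (6 / ε) := by field_simp; norm_num
            _ ≤ _ := by gcongr
        calc _ ≤ (ε / 2 * L p) * k p := by gcongr
          _ = _ := by rw [hN]; ring
      have h5 : 2 * (k p : ℝ) * Real.log 2 ≤ 2 * k p := by nlinarith
      have h6 : (k p : ℝ) * L p = N p := rfl
      have h7 : (1 - α) * (1 - η) * N p = N p - α * N p - 2 * (ε * N p) := by rw [hε]; ring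
      have h8 : (n p : ℝ) * C = n p * Real.log 2 - n p * Real.binEntropy ρ := by rw [hC]; ring
      linarith
  have hlim : Tendsto (fun p => Real.exp (-(t * (ε / 2) * N p)) + Real.exp (-(ε / 2 * N p)))
      atTop (𝓝 0) := by
    have h : ∀ c : ℝ, 0 < c → Tendsto (fun p => Real.exp (-(c * N p))) atTop (𝓝 0) := fun c hc =>
      Real.tendsto_exp_neg_atTop_nhds_zero.comp (hNtop.const_mul_atTop hc)
    simpa using (h (t * (ε / 2)) (by positivity)).add (h (ε / 2) (by positivity))
  have hpos : ∀ᶠ p in atTop, 0 ≤ 1 - gtErrorProb (k p) (q p) ρ ⌊α * (k p : ℝ)⌋₊ (dec p) := by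
    filter_upwards [eventually_le_of_isLittleO hkp] with p hp
    rw [one_sub_gtErrorProb_eq hp]
    exact measureReal_nonneg
  have h0 := squeeze_zero' hpos hbound hlim
  simpa using h0.const_sub 1

/-! ### Hit events and the information density -/

lemma hits_union {p : ℕ} (x : Fin p → Bool) (S T : Finset (Fin p)) :
    hits x (S ∪ T) = (hits x S || hits x T) := by
  rw [Bool.eq_iff_iff]
  simp [hits, or_and_right, exists_or]

lemma sum_rowWeight_not_hits {p : ℕ} (q : ℝ) (T : Finset (Fin p)) :
    ∑ x : Fin p → Bool, rowWeight q x * (if hits x T then 0 else 1) = (1 - q) ^ T.card := by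
  have h : ∀ x : Fin p → Bool, rowWeight q x * (if hits x T then 0 else 1) =
      ∏ j, bernWeight q (x j) * (if j ∈ T then (if x j then 0 else 1) else 1) := by
    intro x
    rw [Finset.prod_mul_distrib, rowWeight]
    congr 1
    by_cases hx : ∃ j ∈ T, x j = true
    · obtain ⟨j, hj, hxj⟩ := hx
      rw [Finset.prod_eq_zero (Finset.mem_univ j) (by simp [hj, hxj])]
      have : hits x T = true := by simpa [hits] using ⟨j, hj, hxj⟩
      simp [this]
    · have : hits x T = false := by simpa [hits] using hx
      rw [Finset.prod_eq_one, this]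
      · simp
      · intro j _
        push Not at hx
        split_ifs with h1 h2
        · exact absurd h2 (hx j h1)
        · rfl
        · rfl
  simp only [h]
  rw [sum_prod_eq_prod_sum
    (fun j b => bernWeight q b * (if j ∈ T then (if b then 0 else 1) else 1))]
  have : ∀ j : Fin p, ∑ b, bernWeight q b * (if j ∈ T then (if b then 0 else 1) else 1) =
      if j ∈ T then 1 - q else 1 := by
    intro j
    split_ifs <;> simp [bernWeight]
  rw [Finset.prod_congr rfl fun j _ => this j]
  simp

/-- Whether a test hits each of three disjoint sets of items are independent events. -/
lemma sum_rowWeight_hits {p : ℕ} (q : ℝ) {T₁ T₂ T₃ : Finset (Fin p)} (h12 : Disjoint T₁ T₂)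
    (h13 : Disjoint T₁ T₃) (h23 : Disjoint T₂ T₃) (F : Bool → Bool → Bool → ℝ) :
    ∑ x : Fin p → Bool, rowWeight q x * F (hits x T₁) (hits x T₂) (hits x T₃) =
      ∑ g, ∑ h, ∑ h', bernWeight (1 - (1 - q) ^ T₁.card) g *
        bernWeight (1 - (1 - q) ^ T₂.card) h * bernWeight (1 - (1 - q) ^ T₃.card) h' *
        F g h h' := by
  set N : Finset (Fin p) → (Fin p → Bool) → ℝ := fun T x => if hits x T then 0 else 1 with hN
  have hE : ∀ T, ∑ x, rowWeight q x * N T x = (1 - q) ^ T.card := sum_rowWeight_not_hits q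
  -- A function of three bits is multilinear in the miss indicators, and a product of miss
  -- indicators is that of the union, with mean a power of `1 - q`.
  have hF : ∀ x, rowWeight q x * F (hits x T₁) (hits x T₂) (hits x T₃) =
      F true true true * rowWeight q x
      + (F false true true - F true true true) * (rowWeight q x * N T₁ x)
      + (F true false true - F true true true) * (rowWeight q x * N T₂ x)
      + (F true true false - F true true true) * (rowWeight q x * N T₃ x)
      + (F false false true - F false true true - F true false true + F true true true) *
        (rowWeight q x * N (T₁ ∪ T₂) x)
      + (F false true false - F false true true - F true true false + F true true true) *
        (rowWeight q x * N (T₁ ∪ T₃) x)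
      + (F true false false - F true false true - F true true false + F true true true) *
        (rowWeight q x * N (T₂ ∪ T₃) x)
      + (F false false false - F false false true - F false true false - F true false false
        + F false true true + F true false true + F true true false - F true true true) *
        (rowWeight q x * N (T₁ ∪ T₂ ∪ T₃) x) := by
    intro x
    simp only [hN, hits_union]
    cases hits x T₁ <;> cases hits x T₂ <;> cases hits x T₃ <;> simp <;> ring
  simp only [hF, Finset.sum_add_distrib, ← Finset.mul_sum, hE, sum_rowWeight]
  rw [Finset.card_union_of_disjoint (Finset.disjoint_union_left.2 ⟨h13, h23⟩),
    Finset.card_union_of_disjoint h12, Finset.card_union_of_disjoint h13,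
    Finset.card_union_of_disjoint h23]
  simp only [Fintype.sum_bool, bernWeight, pow_add, if_true, Bool.false_eq_true, if_false]
  ring

/-- The conditional law of the outcome of a test that hits no item outside a set which is
itself missed with probability `b`. -/
def outWeight (ρ b : ℝ) (y : Bool) : ℝ := b * bernWeight ρ y + (1 - b) * bernWeight ρ (!y)

/-- The likelihood ratio `P(y | x_seq, x_dif) / P(y | x_seq)`, where `g` and `h` tell whether
the test hits the sets `seq` and `dif`, and `b` is the probability of missing `dif`. -/
noncomputable def infoRatio (ρ b : ℝ) (g h y : Bool) : ℝ :=
  if g then 1 else bernWeight ρ (xor y h) / outWeight ρ b y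

/-- The information density of a test in terms of its noise `z`. -/
noncomputable def infoDensity (ρ b : ℝ) (g h z : Bool) : ℝ :=
  if g then 0 else Real.log (bernWeight ρ z) - Real.log (outWeight ρ b (xor h z))

/-- The joint weight of a row of the test matrix and its noise. -/
def testWeight {p : ℕ} (q ρ : ℝ) (a : (Fin p → Bool) × Bool) : ℝ :=
  rowWeight q a.1 * bernWeight ρ a.2

lemma testWeight_nonneg {p : ℕ} {q ρ : ℝ} (hq0 : 0 ≤ q) (hq1 : q ≤ 1) (hρ0 : 0 ≤ ρ)
    (hρ1 : ρ ≤ 1) (a : (Fin p → Bool) × Bool) : 0 ≤ testWeight q ρ a :=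
  mul_nonneg (rowWeight_nonneg hq0 hq1 _) (bernWeight_nonneg hρ0 hρ1 _)

lemma sum_testWeight_hits {p : ℕ} (q ρ : ℝ) {T₁ T₂ T₃ : Finset (Fin p)} (h12 : Disjoint T₁ T₂)
    (h13 : Disjoint T₁ T₃) (h23 : Disjoint T₂ T₃) (F : Bool → Bool → Bool → Bool → ℝ) :
    ∑ a : (Fin p → Bool) × Bool,
      testWeight q ρ a * F (hits a.1 T₁) (hits a.1 T₂) (hits a.1 T₃) a.2 =
      ∑ g, ∑ h, ∑ h', bernWeight (1 - (1 - q) ^ T₁.card) g *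
        bernWeight (1 - (1 - q) ^ T₂.card) h * bernWeight (1 - (1 - q) ^ T₃.card) h' *
        ∑ z, bernWeight ρ z * F g h h' z := by
  rw [← sum_rowWeight_hits q h12 h13 h23 fun g h h' => ∑ z, bernWeight ρ z * F g h h' z,
    Fintype.sum_prod_type]
  simp only [testWeight, Finset.mul_sum, mul_assoc]

lemma sum_testWeight {p : ℕ} (q ρ : ℝ) :
    ∑ a : (Fin p → Bool) × Bool, testWeight q ρ a = 1 := by
  rw [Fintype.sum_prod_type]
  simp only [testWeight, ← Finset.mul_sum, sum_bernWeight, mul_one, sum_rowWeight]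

lemma outWeight_pos {ρ b : ℝ} (hρ0 : 0 ≤ ρ) (hρ : ρ < 1 / 2) (hb0 : 0 < b) (hb1 : b < 1)
    (y : Bool) : 0 < outWeight ρ b y := by
  cases y <;> simp only [outWeight, bernWeight, Bool.not_true, Bool.not_false, if_true,
    Bool.false_eq_true, if_false] <;> nlinarith

/-- The likelihood ratio has mean one if `dif` is independent of the outcome given `seq`. -/
lemma sum_testWeight_mul_infoRatio {p : ℕ} {q ρ : ℝ} (hρ0 : 0 ≤ ρ) (hρ : ρ < 1 / 2)
    {A D D' : Finset (Fin p)} (h12 : Disjoint A D) (h13 : Disjoint A D') (h23 : Disjoint D D')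
    (hb0 : 0 < (1 - q) ^ D.card) (hb1 : (1 - q) ^ D.card < 1) :
    ∑ a : (Fin p → Bool) × Bool, testWeight q ρ a *
      infoRatio ρ ((1 - q) ^ D.card) (hits a.1 A) (hits a.1 D)
        (xor (hits a.1 (A ∪ D')) a.2) = 1 := by
  simp only [hits_union]
  rw [sum_testWeight_hits q ρ h12 h13 h23 fun g h h' z =>
    infoRatio ρ ((1 - q) ^ D.card) g h (xor (g || h') z)]
  have ht := (outWeight_pos hρ0 hρ hb0 hb1 true).ne'
  have hf := (outWeight_pos hρ0 hρ hb0 hb1 false).ne'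
  set b := (1 - q) ^ D.card
  set a := (1 - q) ^ A.card
  set b' := (1 - q) ^ D'.card
  -- If `A` is missed, the outcome depends on `D'` and the noise only. Averaging over whether `D` is
  -- hit turns the numerator into the denominator.
  have h1 : ∀ y, ∑ h, bernWeight (1 - b) h * (bernWeight ρ (xor y h) / outWeight ρ b y) = 1 := by
    intro y
    have hy : outWeight ρ b y ≠ 0 := by cases y <;> assumption
    simp only [← mul_div_assoc, ← Finset.sum_div]
    rw [div_eq_one_iff_eq hy]
    cases y <;> simp [outWeight, bernWeight] <;> ring
  have h1t := h1 true
  have h1f := h1 false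
  simp only [Fintype.sum_bool] at h1t h1f
  simp only [Fintype.sum_bool, infoRatio, Bool.false_eq_true, if_true, if_false, Bool.true_or,
    Bool.false_or, Bool.true_xor, Bool.false_xor, Bool.not_true, Bool.not_false, Bool.or_true,
    Bool.xor_true, Bool.xor_false] at h1t h1f ⊢
  set u := bernWeight ρ true / outWeight ρ b true
  set v := bernWeight ρ false / outWeight ρ b true
  set u' := bernWeight ρ true / outWeight ρ b false
  set v' := bernWeight ρ false / outWeight ρ b false
  have e1 := sum_bernWeight (1 - b)
  have e2 := sum_bernWeight (1 - b')
  have e3 := sum_bernWeight (1 - a)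
  have e4 := sum_bernWeight ρ
  simp only [Fintype.sum_bool] at e1 e2 e3 e4
  generalize bernWeight (1 - b) true = bt at *
  generalize bernWeight (1 - b) false = bf at *
  generalize bernWeight (1 - b') true = bt' at *
  generalize bernWeight (1 - b') false = bf' at *
  generalize bernWeight (1 - a) true = at' at *
  generalize bernWeight (1 - a) false = af' at *
  generalize bernWeight ρ true = rt at *
  generalize bernWeight ρ false = rf at *
  linear_combination (at' * (bt + bf) * (bt' + bf')) * e4 + at' * (bt' + bf') * e1 + at' * e2 + e3
    + af' * (bt' * rt + bf' * rf) * h1f + af' * (bt' * rf + bf' * rt) * h1t +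
      af' * (bt' + bf') * e4 + af' * e2

/-- A test hitting `A` reveals nothing about `D`. Otherwise it is a binary symmetric channel with
input "is `D` hit", so the mean is a conditional mutual information. The spare third set is taken
empty. -/
lemma sum_testWeight_mul_infoDensity {p : ℕ} {q ρ : ℝ} {A D : Finset (Fin p)}
    (h12 : Disjoint A D) :
    ∑ a : (Fin p → Bool) × Bool, testWeight q ρ a *
      infoDensity ρ ((1 - q) ^ D.card) (hits a.1 A) (hits a.1 D) a.2 =
      (1 - q) ^ A.card *
        (Real.binEntropy (outWeight ρ ((1 - q) ^ D.card) true) - Real.binEntropy ρ) := by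
  rw [sum_testWeight_hits q ρ h12 (Finset.disjoint_empty_right A) (Finset.disjoint_empty_right D)
    fun g h _ z => infoDensity ρ ((1 - q) ^ D.card) g h z]
  set b := (1 - q) ^ D.card
  set a := (1 - q) ^ A.card
  have h1 : 1 - outWeight ρ b true = outWeight ρ b false := by
    simp [outWeight, bernWeight]; ring
  simp only [Real.binEntropy, Real.log_inv, h1]
  simp only [Fintype.sum_bool, infoDensity, Bool.false_eq_true, if_true, if_false,
    Bool.true_xor, Bool.false_xor, Bool.not_true, Bool.not_false]
  generalize Real.log (outWeight ρ b true) = lt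
  generalize Real.log (outWeight ρ b false) = lf
  simp [bernWeight, outWeight]
  ring

/-! ### Concavity: information per item -/

/-- The derivative is `r * log (u / (r * u + (1 - r) * v))`, which increases with `u`. -/
lemma convexOn_negMulLog_mix_sub {r v : ℝ} (hr0 : 0 < r) (hr1 : r < 1) (hv : 0 ≤ v) :
    ConvexOn ℝ (Set.Ici 0)
      (fun u => Real.negMulLog (r * u + (1 - r) * v) - r * Real.negMulLog u) := by
  have hd : ∀ u, 0 < u → HasDerivAt
      (fun u => Real.negMulLog (r * u + (1 - r) * v) - r * Real.negMulLog u)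
      (r * (Real.log u - Real.log (r * u + (1 - r) * v))) u := by
    intro u hu
    have hpos : 0 < r * u + (1 - r) * v := by
      have : 0 ≤ (1 - r) * v := mul_nonneg (by linarith) hv
      positivity
    have h1 : HasDerivAt (fun u => r * u + (1 - r) * v) r u := by
      simpa using ((hasDerivAt_id u).const_mul r).add_const ((1 - r) * v)
    have h2 := (Real.hasDerivAt_negMulLog hpos.ne').comp u h1
    have h3 := (Real.hasDerivAt_negMulLog hu.ne').const_mul r
    refine (h2.sub h3).congr_deriv ?_
    ring
  refine MonotoneOn.convexOn_of_deriv (convex_Ici 0) ?_ ?_ ?_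
  · exact ((Real.continuous_negMulLog.comp (by fun_prop)).sub
      (Real.continuous_negMulLog.const_mul r)).continuousOn
  · rw [interior_Ici]
    exact fun u hu => (hd u hu).differentiableAt.differentiableWithinAt
  · rw [interior_Ici]
    intro u hu w hw huw
    simp only [Set.mem_Ioi] at hu hw
    rw [(hd u hu).deriv, (hd w hw).deriv]
    have hv' : 0 ≤ (1 - r) * v := mul_nonneg (by linarith) hv
    have hpu : 0 < r * u + (1 - r) * v := by positivity
    have hpw : 0 < r * w + (1 - r) * v := by positivity
    refine mul_le_mul_of_nonneg_left ?_ hr0.le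
    rw [← Real.log_div hu.ne' hpu.ne', ← Real.log_div hw.ne' hpw.ne']
    refine Real.log_le_log (by positivity) ?_
    rw [div_le_div_iff₀ hpu hpw]
    nlinarith

/-- The preceding convexity, applied at the mixture `r * u + (1 - r) * v` of the points `u` and `v`.
-/
lemma negMulLog_mix_le {r u v : ℝ} (hr0 : 0 < r) (hr1 : r < 1) (hu : 0 ≤ u) (hv : 0 ≤ v) :
    Real.negMulLog (r * (r * u + (1 - r) * v) + (1 - r) * v)
      - r * Real.negMulLog (r * u + (1 - r) * v) ≤
    r * (Real.negMulLog (r * u + (1 - r) * v) - r * Real.negMulLog u)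
      + (1 - r) * ((1 - r) * Real.negMulLog v) := by
  have h := (convexOn_negMulLog_mix_sub hr0 hr1 hv).2 (Set.mem_Ici.2 hu) (Set.mem_Ici.2 hv)
    hr0.le (by linarith : 0 ≤ 1 - r) (by ring)
  simp only [smul_eq_mul] at h
  have hvv : r * v + (1 - r) * v = v := by ring
  rw [hvv] at h
  linarith

/-- The mutual information between the input and the output of a binary symmetric channel whose
input is zero with probability `b`. -/
noncomputable def bscInfo (ρ b : ℝ) : ℝ :=
  Real.binEntropy (outWeight ρ b true) - Real.binEntropy ρ

lemma bscInfo_one (ρ : ℝ) : bscInfo ρ 1 = 0 := by simp [bscInfo, outWeight, bernWeight]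

/-- One more item mixes the outcome law, with weight `1 - r`, with the law of a positive test.
Summing `negMulLog_mix_le` over both outcomes leaves `(1 - r) ^ 2` times the noise entropy, which is
exactly what the entropy terms of `bscInfo` cancel. -/
lemma bscInfo_mul_mul_le {ρ r b : ℝ} (hρ0 : 0 ≤ ρ) (hρ1 : ρ ≤ 1) (hr0 : 0 < r) (hr1 : r < 1)
    (hb0 : 0 ≤ b) (hb1 : b ≤ 1) :
    bscInfo ρ (r * (r * b)) + r ^ 2 * bscInfo ρ b ≤ 2 * r * bscInfo ρ (r * b) := by
  have hy : ∀ b, outWeight ρ b true = b * ρ + (1 - b) * (1 - ρ) := by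
    intro b; simp [outWeight, bernWeight]
  simp only [bscInfo, hy, Real.binEntropy_eq_negMulLog_add_negMulLog_one_sub]
  have h1 := negMulLog_mix_le (u := b * ρ + (1 - b) * (1 - ρ)) (v := 1 - ρ) hr0 hr1
    (by have := mul_nonneg hb0 hρ0
        have := mul_nonneg (sub_nonneg.2 hb1) (sub_nonneg.2 hρ1)
        linarith) (by linarith)
  have h2 := negMulLog_mix_le (u := 1 - (b * ρ + (1 - b) * (1 - ρ))) (v := ρ) hr0 hr1
    (by have := mul_nonneg hb0 (sub_nonneg.2 hρ1)
        have := mul_nonneg (sub_nonneg.2 hb1) hρ0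
        nlinarith) hρ0
  rw [show r * (b * ρ + (1 - b) * (1 - ρ)) + (1 - r) * (1 - ρ)
    = r * b * ρ + (1 - r * b) * (1 - ρ) by ring,
    show r * (r * b * ρ + (1 - r * b) * (1 - ρ)) + (1 - r) * (1 - ρ)
    = r * (r * b) * ρ + (1 - r * (r * b)) * (1 - ρ) by ring] at h1
  rw [show r * (1 - (b * ρ + (1 - b) * (1 - ρ))) + (1 - r) * ρ
    = 1 - (r * b * ρ + (1 - r * b) * (1 - ρ)) by ring,
    show r * (1 - (r * b * ρ + (1 - r * b) * (1 - ρ))) + (1 - r) * ρ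
    = 1 - (r * (r * b) * ρ + (1 - r * (r * b)) * (1 - ρ)) by ring] at h2
  linarith

/-- A concave sequence starting at zero has nonincreasing `u m / m`. -/
lemma mul_le_mul_of_concave_seq {u : ℕ → ℝ} (h0 : u 0 = 0)
    (hu : ∀ m, u (m + 2) + u m ≤ 2 * u (m + 1)) {l k : ℕ} (hlk : l ≤ k) :
    l * u k ≤ k * u l := by
  have hstep : ∀ m : ℕ, (m : ℝ) * u (m + 1) ≤ (m + 1) * u m := by
    intro m
    induction m with
    | zero => simp [h0]
    | succ m ih =>
      have := hu m
      push_cast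
      nlinarith
  induction k, hlk using Nat.le_induction with
  | base => exact le_rfl
  | succ k hlk ih =>
    rcases Nat.eq_zero_or_pos k with rfl | hk
    · obtain rfl : l = 0 := by omega
      simp [h0]
    · have hk0 : (0 : ℝ) < k := by exact_mod_cast hk
      have h1 := hstep k
      have h2 : (k : ℝ) * (l * u (k + 1)) ≤ k * ((k + 1) * u l) := by
        have hl : (0 : ℝ) ≤ l := by positivity
        nlinarith
      push_cast
      exact le_of_mul_le_mul_left h2 hk0

/-- The conditional mutual information per item does not increase with the number of items. -/
lemma div_mul_bscInfo_le {ρ r : ℝ} (hρ0 : 0 ≤ ρ) (hρ1 : ρ ≤ 1) (hr0 : 0 < r) (hr1 : r < 1)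
    {l k : ℕ} (hk : 1 ≤ k) (hlk : l ≤ k) :
    (l : ℝ) / k * bscInfo ρ (r ^ k) ≤ r ^ (k - l) * bscInfo ρ (r ^ l) := by
  -- The right-hand side of the goal is `r ^ k * u l`, so what is needed is `l * u k ≤ k * u l`;
  -- concavity of `u` is `bscInfo_mul_mul_le` divided by `r ^ (m + 2)`.
  have h := mul_le_mul_of_concave_seq (u := fun m => bscInfo ρ (r ^ m) / r ^ m)
    (by simp [bscInfo_one]) (fun m => by
      have h1 := bscInfo_mul_mul_le hρ0 hρ1 hr0 hr1 (pow_nonneg hr0.le m)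
        (pow_le_one₀ hr0.le hr1.le)
      have hm : 0 < r ^ m := pow_pos hr0 m
      have e1 : r * r ^ m = r ^ (m + 1) := by ring
      have e2 : r * r ^ (m + 1) = r ^ (m + 2) := by ring
      rw [e1, e2] at h1
      have h2 : bscInfo ρ (r ^ (m + 2)) / r ^ (m + 2) + bscInfo ρ (r ^ m) / r ^ m
          = (bscInfo ρ (r ^ (m + 2)) + r ^ 2 * bscInfo ρ (r ^ m)) / r ^ (m + 2) := by
        field_simp
        ring
      have h3 : 2 * (bscInfo ρ (r ^ (m + 1)) / r ^ (m + 1))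
          = 2 * r * bscInfo ρ (r ^ (m + 1)) / r ^ (m + 2) := by
        rw [← e2]
        field_simp
      rw [h2, h3]
      gcongr) hlk
  have hk0 : (0 : ℝ) < k := by exact_mod_cast hk
  have hpow : r ^ k = r ^ (k - l) * r ^ l := by rw [← pow_add]; congr 1; omega
  have hl : 0 < r ^ l := pow_pos hr0 l
  have hkp : 0 < r ^ k := pow_pos hr0 k
  calc (l : ℝ) / k * bscInfo ρ (r ^ k)
      = r ^ k / k * (l * (bscInfo ρ (r ^ k) / r ^ k)) := by field_simp
    _ ≤ r ^ k / k * (k * (bscInfo ρ (r ^ l) / r ^ l)) := by gcongr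
    _ = _ := by rw [hpow]; field_simp

/-! ### The threshold decoder and its error bound -/

open Classical in
lemma gtErrorProb_eq_sum {p k n : ℕ} (q ρ : unitInterval) (d : ℕ) (dec : GTDecoder p n) :
    gtErrorProb k q ρ d dec = ((p.choose k : ℕ) : ℝ)⁻¹ *
      ∑ S ∈ Finset.powersetCard k Finset.univ, ∑ ω : Fin n → (Fin p → Bool) × Bool,
        (∏ i, testWeight (q : ℝ) ρ (ω i)) *
          if d < (S \ dec (fun i => (ω i).1) fun i => xor (hits (ω i).1 S) (ω i).2).card ∨
            d < (dec (fun i => (ω i).1) (fun i => xor (hits (ω i).1 S) (ω i).2) \ S).card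
          then 1 else 0 := by
  rw [gtErrorProb, gtLaw_real_eq_sum]
  congr 1
  refine Finset.sum_congr rfl fun S _ => ?_
  rw [← Equiv.sum_comp (Equiv.arrowProdEquivProdArrow (Fin n) (fun _ => Fin p → Bool)
    (fun _ => Bool)).symm, Fintype.sum_prod_type]
  refine Finset.sum_congr rfl fun X _ => ?_
  rw [Finset.mul_sum]
  refine Finset.sum_congr rfl fun Z _ => ?_
  simp only [testWeight, Finset.prod_mul_distrib, ← mul_assoc]
  refine congrArg₂ (· * ·) rfl ?_
  simp only [hits, Set.mem_ofPred_eq]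
  congr 1

/-- The test of a candidate set in the information density decoder. -/
def PassesThreshold {p n : ℕ} (k d : ℕ) (q ρ : ℝ) (γ : ℕ → ℝ) (X : Fin n → Fin p → Bool)
    (Y : Fin n → Bool) (S : Finset (Fin p)) : Prop :=
  S.card = k ∧ ∀ D ⊆ S, d < D.card → Real.exp (γ D.card) ≤
    ∏ i, infoRatio ρ ((1 - q) ^ D.card) (hits (X i) (S \ D)) (hits (X i) D) (Y i)

open Classical in
/-- The information density decoder. -/
noncomputable def thresholdDecoder (p n k d : ℕ) (q ρ : ℝ) (γ : ℕ → ℝ) : GTDecoder p n :=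
  fun X Y => if h : ∃ S, PassesThreshold k d q ρ γ X Y S then h.choose else ∅

lemma infoRatio_nonneg {ρ b : ℝ} (hρ0 : 0 ≤ ρ) (hρ : ρ < 1 / 2) (hb0 : 0 < b) (hb1 : b < 1)
    (g h y : Bool) : 0 ≤ infoRatio ρ b g h y := by
  rw [infoRatio]
  split_ifs
  · exact zero_le_one
  · exact div_nonneg (bernWeight_nonneg hρ0 (by linarith) _) (outWeight_pos hρ0 hρ hb0 hb1 y).le

/-- The hypothesis on `z` excludes impossible noise (`ρ = 0`, `z = true`): there the ratio vanishes
on a miss, while the exponential never does. -/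
lemma infoRatio_eq_exp {ρ b : ℝ} (hρ0 : 0 ≤ ρ) (hρ : ρ < 1 / 2) (hb0 : 0 < b) (hb1 : b < 1)
    (g h z : Bool) (hz : bernWeight ρ z ≠ 0) :
    infoRatio ρ b g h (xor (g || h) z) = Real.exp (infoDensity ρ b g h z) := by
  have hz' : 0 < bernWeight ρ z := (bernWeight_nonneg hρ0 (by linarith) z).lt_of_ne' hz
  cases g
  · simp only [infoRatio, infoDensity, Bool.false_eq_true, if_false, Bool.false_or]
    rw [Real.exp_sub, Real.exp_log hz', Real.exp_log (outWeight_pos hρ0 hρ hb0 hb1 _)]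
    congr 2
    cases h <;> cases z <;> rfl
  · simp [infoRatio, infoDensity]

open Classical in
/-- A non-asymptotic error bound for the information density decoder. -/
lemma gtErrorProb_thresholdDecoder_le {p k n d : ℕ} (hkp : k ≤ p)
    (q ρ : unitInterval) (hq0 : 0 < (q : ℝ)) (hq1 : (q : ℝ) < 1) (hρ : (ρ : ℝ) < 1 / 2)
    {γ : ℕ → ℝ} {B t Δ : ℝ} (ht : 0 ≤ t) (htB : t * B ≤ 1)
    (hB : ∀ l, d < l → l ≤ k → ∀ g h z, |infoDensity ρ ((1 - (q : ℝ)) ^ l) g h z| ≤ B)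
    (hγ : ∀ l, d < l → l ≤ k → γ l + Δ + n * (t * B ^ 2) ≤
      n * ((1 - (q : ℝ)) ^ (k - l) * bscInfo ρ ((1 - (q : ℝ)) ^ l))) :
    gtErrorProb k q ρ d (thresholdDecoder p n k d q ρ γ) ≤
      2 ^ k * Real.exp (-(t * Δ)) + 2 ^ k * ∑ D : Finset (Fin p), Real.exp (-γ D.card) := by
  have hρ0 := ρ.2.1
  have hq2 : (0 : ℝ) < 1 - q := by linarith
  have hq3 : (1 : ℝ) - q < 1 := by linarith
  set r : ℝ := 1 - q with hr
  have hw : ∀ a : (Fin p → Bool) × Bool, 0 ≤ testWeight (q : ℝ) ρ a :=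
    testWeight_nonneg q.2.1 q.2.2 ρ.2.1 ρ.2.2
  have hb0 : ∀ l : ℕ, 0 < r ^ l := fun l => pow_pos hq2 l
  have hb1 : ∀ l : ℕ, d < l → r ^ l < 1 := fun l hl => pow_lt_one₀ hq2.le hq3 (by omega)
  set W : (Fin n → (Fin p → Bool) × Bool) → ℝ := fun ω => ∏ i, testWeight (q : ℝ) ρ (ω i) with hW
  have hW0 : ∀ ω, 0 ≤ W ω := fun ω => Finset.prod_nonneg fun _ _ => hw _
  set R : Finset (Fin p) → Finset (Fin p) → Finset (Fin p) →
      (Fin n → (Fin p → Bool) × Bool) → ℝ := fun S A D ω => ∏ i, infoRatio ρ (r ^ D.card)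
        (hits (ω i).1 A) (hits (ω i).1 D) (xor (hits (ω i).1 S) (ω i).2) with hR
  have hR0 : ∀ S A D ω, d < D.card → 0 ≤ R S A D ω := fun S A D ω hD =>
    Finset.prod_nonneg fun _ _ => infoRatio_nonneg hρ0 hρ (hb0 _) (hb1 _ hD) _ _ _
  have hmain : ∀ S ∈ Finset.powersetCard k (Finset.univ : Finset (Fin p)),
      (∑ ω : Fin n → (Fin p → Bool) × Bool, W ω *
          if d < (S \ thresholdDecoder p n k d q ρ γ (fun i => (ω i).1)
              fun i => xor (hits (ω i).1 S) (ω i).2).card ∨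
            d < (thresholdDecoder p n k d q ρ γ (fun i => (ω i).1)
              (fun i => xor (hits (ω i).1 S) (ω i).2) \ S).card
          then 1 else 0) ≤
      2 ^ k * Real.exp (-(t * Δ)) + 2 ^ k * ∑ D : Finset (Fin p), Real.exp (-γ D.card) := by
    intro S hS
    have hSk : S.card = k := (Finset.mem_powersetCard.1 hS).2
    set U := S.powerset.filter fun D => d < D.card with hU
    set U' := (S.powerset ×ˢ Sᶜ.powerset).filter fun AD => d < AD.2.card with hU'
    -- An error means that the true set fails some threshold, or that the accepted `T` passes the
    -- one for `D = T \ S`. The second event is bounded by Markov's inequality, summed over all `A =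
    -- T ∩ S` and `D`.
    have hpt : ∀ ω : Fin n → (Fin p → Bool) × Bool,
        (if d < (S \ thresholdDecoder p n k d q ρ γ (fun i => (ω i).1)
              fun i => xor (hits (ω i).1 S) (ω i).2).card ∨
            d < (thresholdDecoder p n k d q ρ γ (fun i => (ω i).1)
              (fun i => xor (hits (ω i).1 S) (ω i).2) \ S).card
          then (1 : ℝ) else 0) ≤
        (∑ D ∈ U, if R S (S \ D) D ω < Real.exp (γ D.card) then 1 else 0) +
          ∑ AD ∈ U', Real.exp (-γ AD.2.card) * R S AD.1 AD.2 ω := by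
      intro ω
      have hn1 : 0 ≤ ∑ D ∈ U, if R S (S \ D) D ω < Real.exp (γ D.card) then (1 : ℝ) else 0 :=
        Finset.sum_nonneg fun D _ => by split_ifs <;> norm_num
      have hn2' : ∀ AD ∈ U', 0 ≤ Real.exp (-γ AD.2.card) * R S AD.1 AD.2 ω := fun AD hAD =>
        mul_nonneg (Real.exp_pos _).le (hR0 _ _ _ _ (Finset.mem_filter.1 hAD).2)
      have hn2 := Finset.sum_nonneg hn2'
      set X : Fin n → Fin p → Bool := fun i => (ω i).1
      set Y : Fin n → Bool := fun i => xor (hits (ω i).1 S) (ω i).2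
      by_cases hpass : PassesThreshold k d q ρ γ X Y S
      · have hex : ∃ S, PassesThreshold k d q ρ γ X Y S := ⟨S, hpass⟩
        set T := thresholdDecoder p n k d q ρ γ X Y with hT
        have hTp : PassesThreshold k d q ρ γ X Y T := by
          rw [hT, thresholdDecoder, dif_pos hex]
          exact hex.choose_spec
        -- Both sets have `k` elements, so the two kinds of error coincide.
        have hcard : (S \ T).card = (T \ S).card := by
          have h1 := Finset.card_sdiff_add_card_inter S T
          have h2 := Finset.card_sdiff_add_card_inter T S
          rw [Finset.inter_comm] at h2
          have h3 := hTp.1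
          omega
        simp only [hcard, or_self]
        split_ifs with herr
        · have hmem : (T ∩ S, T \ S) ∈ U' := by
            rw [hU', Finset.mem_filter, Finset.mem_product, Finset.mem_powerset,
              Finset.mem_powerset]
            refine ⟨⟨Finset.inter_subset_right, ?_⟩, herr⟩
            intro j hj
            simpa using (Finset.mem_sdiff.1 hj).2
          have h1 := hTp.2 (T \ S) Finset.sdiff_subset herr
          rw [sdiff_sdiff_right_self, Finset.inf_eq_inter] at h1
          have h2 : (1 : ℝ) ≤ Real.exp (-γ (T \ S).card) * R S (T ∩ S) (T \ S) ω := by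
            calc (1 : ℝ) = Real.exp (-γ (T \ S).card) * Real.exp (γ (T \ S).card) := by
                  rw [← Real.exp_add]; simp
              _ ≤ _ := mul_le_mul_of_nonneg_left h1 (Real.exp_pos _).le
          have h3 := Finset.single_le_sum hn2' hmem
          simp only at h3
          linarith
        · linarith
      · have : ∃ D ∈ U, R S (S \ D) D ω < Real.exp (γ D.card) := by
          by_contra! hcon
          refine hpass ⟨hSk, fun D hD hdD => ?_⟩
          exact hcon D (Finset.mem_filter.2 ⟨Finset.mem_powerset.2 hD, hdD⟩)
        obtain ⟨D, hD, hlt⟩ := this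
        have h1 : (1 : ℝ) ≤ ∑ D ∈ U, if R S (S \ D) D ω < Real.exp (γ D.card) then 1 else 0 := by
          refine le_trans (by rw [if_pos hlt]) (Finset.single_le_sum
            (f := fun D => if R S (S \ D) D ω < Real.exp (γ D.card) then (1 : ℝ) else 0)
            (fun D _ => by split_ifs <;> norm_num) hD)
        split_ifs <;> linarith
    have hmiss : ∀ D ∈ U, ∑ ω, W ω * (if R S (S \ D) D ω < Real.exp (γ D.card) then 1 else 0) ≤
        Real.exp (-(t * Δ)) := by
      intro D hD
      obtain ⟨hDS, hdD⟩ := Finset.mem_filter.1 hD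
      rw [Finset.mem_powerset] at hDS
      have hDk : D.card ≤ k := hSk ▸ Finset.card_le_card hDS
      set g : (Fin p → Bool) × Bool → ℝ := fun a =>
        infoDensity ρ (r ^ D.card) (hits a.1 (S \ D)) (hits a.1 D) a.2 with hg
      have hch := chernoff_lower_tail n (γ := γ D.card) hw (sum_testWeight _ _) (g := g)
        (fun a => hB _ hdD hDk _ _ _) ht htB
      rw [sum_testWeight_mul_infoDensity Finset.sdiff_disjoint] at hch
      have hcardSD : (S \ D).card = k - D.card := by
        rw [Finset.card_sdiff_of_subset hDS, hSk]
      rw [hcardSD] at hch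
      refine le_trans ?_ (hch.trans (Real.exp_le_exp.2 ?_))
      · refine Finset.sum_le_sum fun ω _ => ?_
        rcases (hW0 ω).eq_or_lt with h0 | hpos
        · rw [← h0]; simp only [hW] at h0; rw [← h0]; simp
        · refine mul_le_mul_of_nonneg_left ?_ hpos.le
          have hz : ∀ i, bernWeight (ρ : ℝ) (ω i).2 ≠ 0 := fun i h0 =>
            hpos.ne' (Finset.prod_eq_zero (Finset.mem_univ i) (by simp [testWeight, h0]))
          have hRe : R S (S \ D) D ω = Real.exp (∑ i, g (ω i)) := by
            rw [Real.exp_sum]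
            refine Finset.prod_congr rfl fun i _ => ?_
            rw [hg, ← infoRatio_eq_exp hρ0 hρ (hb0 _) (hb1 _ hdD) _ _ _ (hz i), ← hits_union,
              Finset.sdiff_union_of_subset hDS]
          simp only [hRe, Real.exp_lt_exp]
          split_ifs with h1 h2
          · exact le_rfl
          · exact absurd h1.le h2
          · exact zero_le_one
          · exact le_rfl
      · have := hγ _ hdD hDk
        rw [bscInfo] at this
        have h2 : γ D.card - n * (r ^ (k - D.card) * (Real.binEntropy
          (outWeight ρ (r ^ D.card) true) - Real.binEntropy ρ)) + n * (t * B ^ 2) ≤ -Δ := by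
          linarith
        calc _ ≤ t * -Δ := mul_le_mul_of_nonneg_left h2 ht
          _ = _ := by ring
    have hfalse : ∀ AD ∈ U', ∑ ω, W ω * (Real.exp (-γ AD.2.card) * R S AD.1 AD.2 ω) =
        Real.exp (-γ AD.2.card) := by
      rintro ⟨A, D⟩ hAD
      obtain ⟨hmem, hdD⟩ := Finset.mem_filter.1 hAD
      rw [Finset.mem_product, Finset.mem_powerset, Finset.mem_powerset] at hmem
      obtain ⟨hA, hD⟩ := hmem
      simp only at hA hD hdD ⊢
      have hDS : Disjoint D S := by
        rw [Finset.disjoint_left]; exact fun j hj => by simpa using hD hj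
      -- The choice `D' = S \ A` makes `A ∪ D'` the true set.
      have h1 := sum_testWeight_mul_infoRatio (q := (q : ℝ)) hρ0 hρ (A := A) (D := D) (D' := S \ A)
        (hDS.mono_right hA).symm Finset.disjoint_sdiff (hDS.mono_right Finset.sdiff_subset)
        (hb0 _) (hb1 _ hdD)
      rw [Finset.union_sdiff_of_subset hA] at h1
      have h2 := sum_fun_prod_eq_pow n fun a : (Fin p → Bool) × Bool => testWeight (q : ℝ) ρ a *
        infoRatio ρ ((1 - q) ^ D.card) (hits a.1 A) (hits a.1 D) (xor (hits a.1 S) a.2)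
      rw [h1, one_pow] at h2
      simp only [Finset.prod_mul_distrib] at h2
      simp only [mul_left_comm _ (Real.exp (-γ D.card))]
      rw [← Finset.mul_sum]
      exact (congrArg _ h2).trans (mul_one _)
    calc _ ≤ ∑ ω, W ω * ((∑ D ∈ U, if R S (S \ D) D ω < Real.exp (γ D.card) then 1 else 0) +
          ∑ AD ∈ U', Real.exp (-γ AD.2.card) * R S AD.1 AD.2 ω) :=
          Finset.sum_le_sum fun ω _ => mul_le_mul_of_nonneg_left (hpt ω) (hW0 ω)
      _ = (∑ D ∈ U, ∑ ω, W ω * (if R S (S \ D) D ω < Real.exp (γ D.card) then 1 else 0)) +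
          ∑ AD ∈ U', ∑ ω, W ω * (Real.exp (-γ AD.2.card) * R S AD.1 AD.2 ω) := by
          simp only [mul_add, Finset.sum_add_distrib, Finset.mul_sum]
          rw [Finset.sum_comm, Finset.sum_comm (s := Finset.univ) (t := U')]
      _ ≤ (∑ D ∈ S.powerset, Real.exp (-(t * Δ))) +
          ∑ AD ∈ S.powerset ×ˢ (Finset.univ : Finset (Finset (Fin p))),
            Real.exp (-γ AD.2.card) := by
          refine add_le_add ?_ ?_
          · refine (Finset.sum_le_sum hmiss).trans (Finset.sum_le_sum_of_subset_of_nonneg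
              (Finset.filter_subset _ _) fun _ _ _ => (Real.exp_pos _).le)
          · rw [Finset.sum_congr rfl hfalse]
            refine Finset.sum_le_sum_of_subset_of_nonneg ((Finset.filter_subset _ _).trans
              (Finset.product_subset_product_right (Finset.subset_univ _)))
              fun _ _ _ => (Real.exp_pos _).le
      _ = _ := by
          rw [Finset.sum_product]
          simp [hSk]
  have hC : (0 : ℝ) < p.choose k := by exact_mod_cast Nat.choose_pos hkp
  rw [gtErrorProb_eq_sum, inv_mul_le_iff₀ hC]
  refine (Finset.sum_le_sum hmain).trans (le_of_eq ?_)
  simp [mul_add]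

/-! ### Asymptotics of the achievability part -/

/-- As `1 - ρ > 1 / 2`, each outcome has probability at least `c` once `b` and `1 - b` are at least
`2 * c`. -/
lemma abs_infoDensity_le {ρ b c : ℝ} (hρ0 : 0 ≤ ρ) (hρ : ρ < 1 / 2) (hc : 0 < c)
    (hcb : 2 * c ≤ b) (hcb' : 2 * c ≤ 1 - b) (g h z : Bool) :
    |infoDensity ρ b g h z| ≤ |Real.log ρ| + |Real.log (1 - ρ)| + |Real.log c| := by
  have hout : ∀ y, c ≤ outWeight ρ b y ∧ outWeight ρ b y ≤ 1 := by
    intro y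
    cases y <;> simp only [outWeight, bernWeight, Bool.not_true, Bool.not_false, if_true,
      Bool.false_eq_true, if_false] <;> constructor <;> nlinarith
  rw [infoDensity]
  split_ifs
  · rw [abs_zero]; positivity
  · refine (abs_sub _ _).trans (add_le_add (abs_log_bernWeight_le ρ z) ?_)
    obtain ⟨h1, h2⟩ := hout (xor h z)
    rw [abs_of_nonpos (Real.log_nonpos (hc.le.trans h1) h2),
      abs_of_nonpos (Real.log_nonpos hc.le (h1.trans h2))]
    exact neg_le_neg (Real.log_le_log hc h1)

lemma tendsto_one_sub_logTwoDiv_pow {k : ℕ → ℕ} (hk : Tendsto k atTop atTop) :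
    Tendsto (fun p => (1 - (logTwoDiv (k p) : ℝ)) ^ k p) atTop (𝓝 (1 / 2)) := by
  have h := (Real.tendsto_one_add_div_pow_exp (-Real.log 2)).comp hk
  rw [Real.exp_neg, Real.exp_log two_pos, ← one_div] at h
  refine h.congr fun p => ?_
  simp [logTwoDiv, neg_div, ← sub_eq_add_neg]

lemma continuous_bscInfo (ρ : ℝ) : Continuous (bscInfo ρ) := by
  unfold bscInfo outWeight
  exact (Real.binEntropy_continuous.comp (by fun_prop)).sub continuous_const

lemma bscInfo_half (ρ : ℝ) : bscInfo ρ (1 / 2) = Real.log 2 - Real.binEntropy ρ := by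
  have : outWeight ρ (1 / 2) true = 2⁻¹ := by simp [outWeight, bernWeight]; ring
  rw [bscInfo, this, Real.binEntropy_two_inv]

lemma logTwoDiv_pos {k : ℕ} (hk : 1 ≤ k) : 0 < (logTwoDiv k : ℝ) := by
  have : (0 : ℝ) < k := by exact_mod_cast hk
  exact div_pos (Real.log_pos one_lt_two) this

lemma logTwoDiv_lt_one {k : ℕ} (hk : 1 ≤ k) : (logTwoDiv k : ℝ) < 1 := by
  have hk' : (1 : ℝ) ≤ k := by exact_mod_cast hk
  refine (div_lt_one (by linarith)).2 (lt_of_lt_of_le ?_ hk')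
  linarith [Real.log_two_lt_d9]

/-- Here `s` is the quadratic Chernoff term per test. The losses in `I` and `s` cost a fraction `κ`
each, leaving `n * (I - s) ≥ (1 + η / 2) * l * L`; half of the surplus pays for `3 * K`, half for
the margin. -/
lemma threshold_add_le {K α η C κ l L n I s : ℝ} (hK : 0 < K) (hα : 0 < α) (hη : 0 < η)
    (hC : 0 < C) (hκ : 0 < κ) (hκη : (1 + η) * (1 - 2 * κ) = 1 + η / 2) (hl : α * K ≤ l)
    (hL : 12 / (η * α) ≤ L) (hn : K * L / C * (1 + η) ≤ n) (hI : l / K * (C * (1 - κ)) ≤ I)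
    (hs : s ≤ κ * α * C) :
    l * L + 3 * K + η / 4 * α * (K * L) + n * s ≤ n * I := by
  have hL0 : 0 < L := lt_of_lt_of_le (by positivity) hL
  have hl0 : 0 < l := lt_of_lt_of_le (by positivity) hl
  have hn0 : 0 < n := lt_of_lt_of_le (by positivity) hn
  have h4 : s ≤ l / K * (C * κ) := by
    have : α ≤ l / K := (le_div_iff₀ hK).2 hl
    calc s ≤ κ * α * C := hs
      _ = α * (C * κ) := by ring
      _ ≤ _ := by gcongr
  have hκ1 : 0 ≤ 1 - 2 * κ := by
    have : 0 < (1 + η) * (1 - 2 * κ) := by rw [hκη]; positivity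
    exact ((pos_iff_pos_of_mul_pos this).1 (by positivity)).le
  have h5 : (1 + η / 2) * (l * L) ≤ n * (l / K * (C * (1 - 2 * κ))) := by
    calc (1 + η / 2) * (l * L)
        = (K * L / C * (1 + η)) * (l / K * (C * (1 - 2 * κ))) := by
          rw [← hκη]; field_simp
      _ ≤ _ := by gcongr
  have h6 : n * (l / K * (C * (1 - 2 * κ))) ≤ n * (I - s) := by
    refine mul_le_mul_of_nonneg_left ?_ hn0.le
    linarith
  have h7 : α * (K * L) ≤ l * L := by
    calc α * (K * L) = α * K * L := by ring
      _ ≤ _ := by gcongr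
  have h8 : 3 * K ≤ η / 4 * (α * (K * L)) := by
    have : 3 ≤ η / 4 * α * L := by
      calc (3 : ℝ) = η / 4 * α * (12 / (η * α)) := by field_simp; norm_num
        _ ≤ _ := by gcongr
    calc _ ≤ η / 4 * α * L * K := by gcongr
      _ = _ := by ring
  have h9 : η / 2 * (α * (K * L)) ≤ η / 2 * (l * L) := by gcongr
  linarith

lemma one_sub_logTwoDiv_pow_le {k l : ℕ} {α : ℝ} (hk : 1 ≤ k) (hl : α * k ≤ l) :
    (1 - (logTwoDiv k : ℝ)) ^ l ≤ Real.exp (-(α * Real.log 2)) := by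
  have hk0 : (0 : ℝ) < k := by exact_mod_cast hk
  calc (1 - (logTwoDiv k : ℝ)) ^ l ≤ Real.exp (-(logTwoDiv k : ℝ)) ^ l :=
        pow_le_pow_left₀ (by linarith [logTwoDiv_lt_one hk]) (Real.one_sub_le_exp_neg _) l
    _ = Real.exp (l * -(Real.log 2 / k)) := by rw [← Real.exp_nat_mul]; rfl
    _ ≤ _ := by
        refine Real.exp_le_exp.2 ?_
        have h2 : α * Real.log 2 ≤ l * (Real.log 2 / k) := by
          rw [mul_div_assoc', le_div_iff₀ hk0]
          calc α * Real.log 2 * k = α * k * Real.log 2 := by ring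
            _ ≤ _ := mul_le_mul_of_nonneg_right hl (Real.log_pos one_lt_two).le
        linarith

/-- Of the `3 * k` in the threshold, one `k` absorbs `2 ^ k`, one the factor `exp k` from the sum
over `D`, and one is left as decay. -/
lemma union_bound_le {p k : ℕ} (hk : 1 ≤ k) (hkp : k ≤ p) {L c : ℝ}
    (hL : (p : ℝ) / k = Real.exp L) (hc : 2 ≤ c * L) :
    2 ^ k * Real.exp (-(c * (k * L))) +
      2 ^ k * ∑ D : Finset (Fin p), Real.exp (-(D.card * L + 3 * k)) ≤
      2 * Real.exp (-(k : ℝ)) := by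
  have hk0 : (0 : ℝ) < k := by exact_mod_cast hk
  have hp0 : (0 : ℝ) < p := hk0.trans_le (by exact_mod_cast hkp)
  have h2 : (2 : ℝ) ^ k ≤ Real.exp (k * 1) := by
    rw [Real.exp_nat_mul]
    exact pow_le_pow_left₀ two_pos.le (by linarith [Real.add_one_le_exp (1 : ℝ)]) k
  rw [mul_one] at h2
  have hA : 2 ^ k * Real.exp (-(c * (k * L))) ≤ Real.exp (-(k : ℝ)) := by
    calc _ ≤ Real.exp k * Real.exp (-(c * (k * L))) := by gcongr
      _ ≤ _ := by
        rw [← Real.exp_add]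
        refine Real.exp_le_exp.2 ?_
        nlinarith
  have hS : ∑ D : Finset (Fin p), Real.exp (-(D.card * L + 3 * k)) ≤ Real.exp (-(2 * k)) := by
    calc ∑ D : Finset (Fin p), Real.exp (-(D.card * L + 3 * k))
        = Real.exp (-(3 * k)) * ∑ D : Finset (Fin p), ((k : ℝ) / p) ^ D.card := by
          rw [Finset.mul_sum]
          refine Finset.sum_congr rfl fun D _ => ?_
          rw [← inv_div, hL, ← Real.exp_neg, ← Real.exp_nat_mul, ← Real.exp_add]
          congr 1
          ring
      _ ≤ Real.exp (-(3 * k)) * Real.exp (p * ((k : ℝ) / p)) := by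
          gcongr
          exact sum_pow_card_le_exp p (by positivity)
      _ = _ := by
          rw [← Real.exp_add]
          congr 1
          field_simp
          ring
  have hS' : 2 ^ k * ∑ D : Finset (Fin p), Real.exp (-(D.card * L + 3 * k)) ≤
      Real.exp (-(k : ℝ)) := by
    calc _ ≤ Real.exp k * Real.exp (-(2 * k)) := by gcongr
      _ = _ := by
        rw [← Real.exp_add]
        congr 1
        ring
  linarith

theorem exists_decoder_tendsto_gtErrorProb_zero (ρ : unitInterval) (hρ : (ρ : ℝ) < 1 / 2)
    (α : ℝ) (hα0 : 0 < α) (k n : ℕ → ℕ) (hk : Tendsto k atTop atTop)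
    (hkp : (fun p => (k p : ℝ)) =o[atTop] (fun p : ℕ => (p : ℝ)))
    {η : ℝ} (hη : 0 < η) (hn : ∀ᶠ p : ℕ in atTop,
        ((k p : ℝ) * Real.log ((p : ℝ) / (k p : ℝ))) / (Real.log 2 - Real.binEntropy (ρ : ℝ))
          * (1 + η) ≤ (n p : ℝ)) :
    ∃ dec : ∀ p : ℕ, GTDecoder p (n p),
      Tendsto (fun p : ℕ => gtErrorProb (k p) (logTwoDiv (k p)) ρ ⌊α * (k p : ℝ)⌋₊ (dec p))
        atTop (𝓝 0) := by
  have hρ0 := ρ.2.1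
  have hρ1 := ρ.2.2
  set C := Real.log 2 - Real.binEntropy (ρ : ℝ) with hC
  have hC0 : 0 < C := log_two_sub_binEntropy_pos hρ
  set κ := η / (4 * (1 + η)) with hκ
  have hκ0 : 0 < κ := by positivity
  have hκη : (1 + η) * (1 - 2 * κ) = 1 + η / 2 := by rw [hκ]; field_simp; ring
  set x := Real.exp (-(α * Real.log 2)) with hx
  have hx1 : x < 1 := by
    rw [hx, Real.exp_lt_one_iff]
    have := Real.log_pos one_lt_two
    nlinarith
  -- For `α k ≤ l ≤ k` one has `r ^ l ≤ x`, and eventually `r ^ l ≥ r ^ k ≥ 1 / 4`; so `2 * c` is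
  -- below both `1 - r ^ l` and `r ^ l`.
  set c := min (1 / 8) ((1 - x) / 2) with hc
  have hc0 : 0 < c := lt_min (by norm_num) (by linarith)
  have hc1 : 2 * c ≤ 1 / 4 := by linarith [min_le_left (1 / 8) ((1 - x) / 2)]
  have hc2 : 2 * c ≤ 1 - x := by linarith [min_le_right (1 / 8) ((1 - x) / 2)]
  set B := |Real.log ρ| + |Real.log (1 - ρ)| + |Real.log c| + 1 with hB
  have hB0 : 0 < B := by positivity
  set t := min (1 / B) (κ * α * C / B ^ 2) with ht
  have ht0 : 0 < t := lt_min (by positivity) (by positivity)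
  have htB : t * B ≤ 1 := by
    calc t * B ≤ 1 / B * B := by gcongr; exact min_le_left _ _
      _ = 1 := by field_simp
  have htB2 : t * B ^ 2 ≤ κ * α * C := by
    calc t * B ^ 2 ≤ κ * α * C / B ^ 2 * B ^ 2 := by gcongr; exact min_le_right _ _
      _ = _ := by field_simp
  set L : ℕ → ℝ := fun p => Real.log ((p : ℝ) / (k p : ℝ)) with hL
  have hLtop : Tendsto L atTop atTop := tendsto_log_div_atTop hk hkp
  have hkR : Tendsto (fun p => (k p : ℝ)) atTop atTop := tendsto_natCast_atTop_atTop.comp hk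
  have hβ := tendsto_one_sub_logTwoDiv_pow hk
  have hI : ∀ᶠ p in atTop, C * (1 - κ) ≤ bscInfo ρ ((1 - (logTwoDiv (k p) : ℝ)) ^ k p) := by
    have h := ((continuous_bscInfo (ρ : ℝ)).tendsto (1 / 2)).comp hβ
    rw [bscInfo_half] at h
    exact h.eventually_const_le (by nlinarith)
  refine ⟨fun p => thresholdDecoder p (n p) (k p) ⌊α * (k p : ℝ)⌋₊ (logTwoDiv (k p)) ρ
    fun l => l * L p + 3 * k p, ?_⟩
  have hbound : ∀ᶠ p in atTop, gtErrorProb (k p) (logTwoDiv (k p)) ρ ⌊α * (k p : ℝ)⌋₊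
      (thresholdDecoder p (n p) (k p) ⌊α * (k p : ℝ)⌋₊ (logTwoDiv (k p)) ρ
        fun l => l * L p + 3 * k p) ≤ 2 * Real.exp (-(k p : ℝ)) := by
    filter_upwards [hn, hk.eventually_ge_atTop 1, eventually_le_of_isLittleO hkp,
      hLtop.eventually_ge_atTop 0, hLtop.eventually_ge_atTop (12 / (η * α)),
      hLtop.eventually_ge_atTop (8 / (t * η * α)), hI,
      hβ.eventually_const_le (show (1 / 4 : ℝ) < 1 / 2 by norm_num)]
      with p hnp hk1 hkp1 hL0 hL1 hL2 hIp hβp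
    have hk0 : (0 : ℝ) < k p := by exact_mod_cast hk1
    have hp0 : (0 : ℝ) < p := hk0.trans_le (by exact_mod_cast hkp1)
    have hq0 := logTwoDiv_pos hk1
    have hq1 := logTwoDiv_lt_one hk1
    have hr0 : (0 : ℝ) < 1 - logTwoDiv (k p) := by linarith
    have hr1 : (1 : ℝ) - logTwoDiv (k p) < 1 := by linarith
    have hl : ∀ l : ℕ, ⌊α * (k p : ℝ)⌋₊ < l → α * k p ≤ l := fun l h =>
      (Nat.lt_of_floor_lt h).le
    have hexp : (p : ℝ) / k p = Real.exp (L p) := (Real.exp_log (by positivity)).symm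
    refine (gtErrorProb_thresholdDecoder_le (B := B) (t := t) (Δ := η / 4 * α * (k p * L p))
      hkp1 _ ρ hq0 hq1 hρ ht0.le htB ?_ ?_).trans ?_
    · intro l hdl hlk g h z
      refine (abs_infoDensity_le hρ0 hρ hc0 ?_ ?_ g h z).trans (by rw [hB]; linarith)
      · refine hc1.trans (hβp.trans ?_)
        exact pow_le_pow_of_le_one hr0.le hr1.le hlk
      · have h1 : (1 - (logTwoDiv (k p) : ℝ)) ^ l ≤ x :=
          one_sub_logTwoDiv_pow_le hk1 (hl l hdl)
        linarith
    · intro l hdl hlk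
      have hl1 := hl l hdl
      have hl0 : (0 : ℝ) ≤ l := by positivity
      have h1 := div_mul_bscInfo_le hρ0 hρ1 hr0 hr1 hk1 hlk
      have h3 : (l : ℝ) / k p * (C * (1 - κ)) ≤ (l : ℝ) / k p *
          bscInfo ρ ((1 - (logTwoDiv (k p) : ℝ)) ^ k p) := by gcongr
      exact threshold_add_le hk0 hα0 hη hC0 hκ0 hκη hl1 hL1 hnp (h3.trans h1) htB2
    · have h3 : 2 ≤ t * (η / 4 * α) * L p := by
        calc (2 : ℝ) = t * (η / 4 * α) * (8 / (t * η * α)) := by field_simp; norm_num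
          _ ≤ _ := by gcongr
      rw [← mul_assoc t]
      exact union_bound_le hk1 hkp1 hexp h3
  refine squeeze_zero' (Eventually.of_forall fun p => gtErrorProb_nonneg _ _ _ _) hbound ?_
  simpa using (Real.tendsto_exp_neg_atTop_nhds_zero.comp hkR).const_mul 2

theorem corollary8 (ρ : unitInterval) (hρ : (ρ : ℝ) < 1 / 2)
    (α : ℝ) (hα0 : 0 < α) (hα1 : α < 1)
    (k n : ℕ → ℕ)
    (hk : Tendsto k atTop atTop)
    (hkp : (fun p => (k p : ℝ)) =o[atTop] (fun p : ℕ => (p : ℝ))) :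
    ((∃ η : ℝ, 0 < η ∧ ∀ᶠ p : ℕ in atTop,
        ((k p : ℝ) * Real.log ((p : ℝ) / (k p : ℝ))) / (Real.log 2 - Real.binEntropy (ρ : ℝ))
          * (1 + η) ≤ (n p : ℝ)) →
      ∃ dec : ∀ p : ℕ, GTDecoder p (n p),
        Tendsto (fun p : ℕ => gtErrorProb (k p) (logTwoDiv (k p)) ρ ⌊α * (k p : ℝ)⌋₊ (dec p))
          atTop (𝓝 0)) ∧
    ((∃ η : ℝ, 0 < η ∧ ∀ᶠ p : ℕ in atTop,
        (n p : ℝ) ≤ ((1 - α) * ((k p : ℝ) * Real.log ((p : ℝ) / (k p : ℝ))))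
          / (Real.log 2 - Real.binEntropy (ρ : ℝ)) * (1 - η)) →
      ∀ dec : ∀ p : ℕ, GTDecoder p (n p),
        Tendsto (fun p : ℕ => gtErrorProb (k p) (logTwoDiv (k p)) ρ ⌊α * (k p : ℝ)⌋₊ (dec p))
          atTop (𝓝 1)) := by
  refine ⟨?_, ?_⟩
  · rintro ⟨η, hη, hn⟩
    exact exists_decoder_tendsto_gtErrorProb_zero ρ hρ α hα0 k n hk hkp hη hn
  · rintro ⟨η, hη, hn⟩ dec
    exact tendsto_gtErrorProb_one ρ hρ α hα0 hα1 k n hk hkp hη hn _ dec
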